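/- Let $\omega_1,\omega_2\in\mathbb{C}$ be linearly independent over $\mathbb{R}$, $\Omega=\mathbb{Z}\omega_1\oplus\mathbb{Z}\omega_2$, $c\in\mathbb{C}$, and $$[u]=e^{2\pi\sqrt{-1}\,cu^2}\,\sigma(u;\Omega),\qquad \sigma(u;\Omega)=u\prod_{\omega\in\Omega\setminus\{0\}}\Bigl(1-\frac{u}{\omega}\Bigr)e^{\frac{u}{\omega}+\frac{u^2}{2\omega^2}} .$$ Write $[x\pm y]=[x+y][x-y]$. Let $\delta\in\mathbb{C}\setminus\{0\}$ with $\mathbb{Z}\delta\cap\Omega=\{0\}$. For $a=(a_0,a_1,a_2,a_3)\in\mathbb{C}^4$ put $$B^+(x;a)=\frac{\prod_{p=0}^3[x+a_p]}{[2x]},\qquad B^-(x;a)=-\frac{\prod_{p=0}^3[x-a_p]}{[2x]} .$$ Suppose that $\sum_{p=0}^3a_p=\delta$ and put $b_p=\delta/2-a_p$ (so that $\sum_{p=0}^3b_p=\delta$ also). Then, for two sets of variables $z=(z_1,\dots,z_N)$, $w=(w_1,\dots,w_N)$ and for every $r=0,1,\dots,N$, \begin{align*} &\sum_{\substack{I\subset\{1,\dots,N\}\\|I|=r}}\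 \sum_{I_+\sqcup I_-=I}\ \prod_{i\in I_+}B^+(z_i;a)\prod_{i\in I_-}B^-(z_i;a) \prod_{\{i,j\}\subset I_+}\frac{[z_i+z_j+\delta]}{[z_i+z_j]} \prod_{\{i,j\}\subset I_-}\frac{[z_i+z_j-\delta]}{[z_i+z_j]} \prod_{\substack{i\in I_+\\j\in I_-}}\frac{[z_i-z_j+\delta]}{[z_i-z_j]}\\ &\quad\cdot \prod_{\substack{i\in I_+\\j\notin I}}\frac{[z_i+\frac{\delta}{2}\pm z_j]}{[z_i\pm z_j]} \prod_{\substack{i\in I_-\\j\notin I}}\frac{[z_i-\frac{\delta}{2}\pm z_j]}{[z_i\pm z_j]} \prod_{\substack{i\in I_+\\1\le k\le N}}\frac{[z_i\pm w_k]}{[z_i+\frac{\delta}{2}\pm w_k]} \prod_{\substack{i\in I_-\\1\le k\le N}}\frac{[z_i\pm w_k]}{[z_i-\frac{\delta}{2}\pm w_k]}\\ &=(-1)^r\sum_{\substack{K\subset\{1,\dots,N\}\\|K|=r}}\ \sum_{K_+\sqcup K_-=K}\ \prod_{k\in K_+}B^+(w_k;b)\prod_{k\in K_-}B^-(w_k;b)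 \prod_{\{k,l\}\subset K_+}\frac{[w_k+w_l+\delta]}{[w_k+w_l]} \prod_{\{k,l\}\subset K_-}\frac{[w_k+w_l-\delta]}{[w_k+w_l]} \prod_{\substack{k\in K_+\\l\in K_-}}\frac{[w_k-w_l+\delta]}{[w_k-w_l]}\\ &\quad\cdot \prod_{\substack{k\in K_+\\l\notin K}}\frac{[w_k+\frac{\delta}{2}\pm w_l]}{[w_k\pm w_l]} \prod_{\substack{k\in K_-\\l\notin K}}\frac{[w_k-\frac{\delta}{2}\pm w_l]}{[w_k\pm w_l]} \prod_{\substack{k\in K_+\\1\le i\le N}}\frac{[w_k\pm z_i]}{[w_k+\frac{\delta}{2}\pm z_i]} \prod_{\substack{k\in K_-\\1\le i\le N}}\frac{[w_k\pm z_i]}{[w_k-\frac{\delta}{2}\pm z_i]} . \end{align*} Here $I_+\sqcup I_-=I$ means that $I_+,I_-$ are disjoint subsets with union $I$, $\{i,j\}\subset I_\pm$ runs over two-element subsets, and $j\notin I$ runs over $\{1,\dots,N\}\setminus I$. The identity holds at all points $z,w\in\mathbb{C}^N$ at which no denominator vanishes, that is, $[2z_i]$, $[2w_k]$, $[z_i\pm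 z_j]$ $(i\ne j)$, $[w_k\pm w_l]$ $(k\neq l)$, $[z_i+\frac{\delta}{2}\pm w_k]$ and $[z_i-\frac{\delta}{2}\pm w_k]$ are all non-zero. -/

import Mathlib

noncomputable section

namespace TypeCDuality

open Finset

/-- The factor `(1 - u/ω) exp (u/ω + u²/(2ω²))` of the Weierstrass sigma function. -/
def sigmaFactor (u ω : ℂ) : ℂ :=
  (1 - u / ω) * Complex.exp (u / ω + u ^ 2 / (2 * ω ^ 2))

lemma norm_sigmaFactor_sub_one_le {u ω : ℂ} (h : ‖u / ω‖ ≤ 1 / 2) :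
    ‖sigmaFactor u ω - 1‖ ≤ 2 * ‖u / ω‖ ^ 3 := by
  set x := u / ω with hx
  have hlt : ‖-x‖ < 1 := by rw [norm_neg]; linarith
  have h1 := Complex.norm_log_sub_logTaylor_le 2 hlt
  set t := Complex.log (1 + -x) - Complex.logTaylor (2 + 1) (-x) with ht
  have htay : Complex.logTaylor (2 + 1) (-x) = -x - x ^ 2 / 2 := by
    simp [Complex.logTaylor_succ, Complex.logTaylor_zero]
    ring
  have hne : (1 : ℂ) + -x ≠ 0 := by
    intro h0
    have : x = 1 := by linear_combination -h0
    rw [this] at h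
    norm_num at h
  have hfac : sigmaFactor u ω = Complex.exp t := by
    have e : Complex.exp t = Complex.exp (Complex.log (1 + -x)) * Complex.exp (x + x ^ 2 / 2) := by
      rw [← Complex.exp_add, ht, htay]
      ring_nf
    rw [e, Complex.exp_log hne, sigmaFactor, ← hx, hx, div_pow]
    congr 2
    · ring
  have hinv : (1 - ‖x‖)⁻¹ ≤ 2 := by
    rw [inv_le_comm₀ (by linarith) (by norm_num)]
    linarith
  have hx3 : 0 ≤ ‖x‖ ^ 3 := by positivity
  have hle : ‖t‖ ≤ ‖x‖ ^ 3 := by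
    rw [norm_neg] at h1
    refine h1.trans ?_
    norm_num
    nlinarith
  have hle1 : ‖x‖ ^ 3 ≤ 1 := pow_le_one₀ (norm_nonneg _) (by linarith)
  rw [hfac]
  exact (Complex.norm_exp_sub_one_le (hle.trans hle1)).trans (by linarith)

lemma summable_sigmaFactor (L : PeriodPair) (u : ℂ) :
    Summable fun ω : {ω : L.lattice // ω ≠ 0} ↦ ‖sigmaFactor u (ω.1 : ℂ) - 1‖ := by
  have hfr : Module.finrank ℤ L.lattice < 3 := by
    rw [Module.finrank_eq_card_basis L.latticeBasis]
    simp
  have h := ((ZLattice.summable_norm_pow_inv L.lattice 3 hfr).comp_injective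
    (Subtype.val_injective (p := fun ω : L.lattice ↦ ω ≠ 0))).mul_left (‖u‖ ^ 3)
  have hev : ∀ᶠ ω : {ω : L.lattice // ω ≠ 0} in Filter.cofinite,
      ‖u‖ ^ 3 * ‖ω.1‖⁻¹ ^ 3 < 1 / 8 :=
    h.tendsto_cofinite_zero.eventually_lt_const (by norm_num)
  refine Summable.of_norm_bounded_eventually (h.mul_left 2) ?_
  filter_upwards [hev] with ω hω
  have e : ‖u‖ ^ 3 * ‖ω.1‖⁻¹ ^ 3 = ‖u / (ω.1 : ℂ)‖ ^ 3 := by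
    rw [norm_div, div_eq_mul_inv, mul_pow]
    rfl
  rw [norm_norm]
  refine (norm_sigmaFactor_sub_one_le ?_).trans_eq ?_
  · rw [e] at hω
    by_contra! hc
    have : (1 / 2 : ℝ) ^ 3 < ‖u / (ω.1 : ℂ)‖ ^ 3 := by gcongr
    norm_num at this hω
    linarith
  · simp only [Function.comp_apply, e]

/-- The product in the definition of the sigma function converges, for every `u`. -/
lemma multipliable_sigmaFactor (L : PeriodPair) (u : ℂ) :
    Multipliable fun ω : {ω : L.lattice // ω ≠ 0} ↦ sigmaFactor u (ω.1 : ℂ) := by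
  simpa using multipliable_one_add_of_summable (summable_sigmaFactor L u)

/-- The Weierstrass sigma function
`σ(u; Ω) = u ∏_{ω ∈ Ω \ {0}} (1 - u/ω) exp (u/ω + u²/(2ω²))`
of the period lattice `Ω = ℤ ω₁ ⊕ ℤ ω₂`. -/
def sigma (L : PeriodPair) (u : ℂ) : ℂ :=
  u * ∏' ω : {ω : L.lattice // ω ≠ 0}, sigmaFactor u (ω.1 : ℂ)

/-- The function `[u] = e(c u²) σ(u; Ω)`, where `e(t) = exp (2 π √-1 t)`. -/
def br (L : PeriodPair) (c u : ℂ) : ℂ :=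
  Complex.exp (2 * Real.pi * Complex.I * (c * u ^ 2)) * sigma L u

/-- The abbreviation `[x ± y] = [x + y] [x - y]`. -/
def brPM (L : PeriodPair) (c x y : ℂ) : ℂ :=
  br L c (x + y) * br L c (x - y)

/-- The coefficient `B⁺(x; a) = ∏_p [x + a_p] / [2x]`. -/
def Bplus (L : PeriodPair) (c : ℂ) (a : Fin 4 → ℂ) (x : ℂ) : ℂ :=
  (∏ p, br L c (x + a p)) / br L c (2 * x)

/-- The coefficient `B⁻(x; a) = - ∏_p [x - a_p] / [2x]`. -/
def Bminus (L : PeriodPair) (c : ℂ) (a : Fin 4 → ℂ) (x : ℂ) : ℂ :=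
  -((∏ p, br L c (x - a p)) / br L c (2 * x))

/-- The summand attached to two disjoint sets of indices `P = I₊` and `M = I₋`.
A product over two-element subsets `{i, j}` is written as a product over the pairs `i < j`;
the indices outside `P ∪ M` are those whose variable is not shifted. -/
def term (L : PeriodPair) (c δ : ℂ) (a : Fin 4 → ℂ) {N : ℕ} (z w : Fin N → ℂ)
    (P M : Finset (Fin N)) : ℂ :=
  (∏ i ∈ P, Bplus L c a (z i)) * (∏ i ∈ M, Bminus L c a (z i))
  * (∏ i ∈ P, ∏ j ∈ P with i < j, br L c (z i + z j + δ) / br L c (z i + z j))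
  * (∏ i ∈ M, ∏ j ∈ M with i < j, br L c (z i + z j - δ) / br L c (z i + z j))
  * (∏ i ∈ P, ∏ j ∈ M, br L c (z i - z j + δ) / br L c (z i - z j))
  * (∏ i ∈ P, ∏ j ∈ (P ∪ M)ᶜ, brPM L c (z i + δ / 2) (z j) / brPM L c (z i) (z j))
  * (∏ i ∈ M, ∏ j ∈ (P ∪ M)ᶜ, brPM L c (z i - δ / 2) (z j) / brPM L c (z i) (z j))
  * (∏ i ∈ P, ∏ k, brPM L c (z i) (w k) / brPM L c (z i + δ / 2) (w k))
  * (∏ i ∈ M, ∏ k, brPM L c (z i) (w k) / brPM L c (z i - δ / 2) (w k))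

/-- The sum over all `I ⊆ {1, …, N}` with `|I| = r` and over all splittings
`I = I₊ ∪ I₋` into disjoint subsets (`I₊ ⊆ I` is arbitrary and `I₋ = I \ I₊`). -/
def subsetSum (L : PeriodPair) (c δ : ℂ) (a : Fin 4 → ℂ) {N : ℕ} (z w : Fin N → ℂ)
    (r : ℕ) : ℂ :=
  ∑ I ∈ powersetCard r (univ : Finset (Fin N)), ∑ P ∈ I.powerset,
    term L c δ a z w P (I \ P)

end TypeCDuality

end

noncomputable section

namespace TypeCDuality

open Finset Filter Topology

set_option linter.unusedSectionVars false

/-- The infinite product in the definition of the sigma function. -/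
def sigmaProd (L : PeriodPair) (u : ℂ) : ℂ :=
  ∏' ω : {ω : L.lattice // ω ≠ 0}, sigmaFactor u (ω.1 : ℂ)

lemma sigma_eq_mul_sigmaProd (L : PeriodPair) (u : ℂ) : sigma L u = u * sigmaProd L u := rfl

lemma differentiable_sigmaFactor (ω : ℂ) : Differentiable ℂ fun u ↦ sigmaFactor u ω := by
  unfold sigmaFactor
  fun_prop

lemma sigmaFactor_eq_zero_iff {u ω : ℂ} (hω : ω ≠ 0) : sigmaFactor u ω = 0 ↔ u = ω := by
  simp only [sigmaFactor, mul_eq_zero, Complex.exp_ne_zero, or_false, sub_eq_zero]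
  rw [eq_comm, div_eq_one_iff_eq hω]

lemma lattice_coe_ne_zero {L : PeriodPair} (ω : {ω : L.lattice // ω ≠ 0}) : (ω.1 : ℂ) ≠ 0 := by
  have := ω.2
  simpa using this

lemma sigmaProd_ne_zero {L : PeriodPair} {u : ℂ} (hu : u ∉ L.lattice ∨ u = 0) :
    sigmaProd L u ≠ 0 := by
  have h := tprod_one_add_ne_zero_of_summable (R := ℂ)
    (f := fun ω : {ω : L.lattice // ω ≠ 0} ↦ sigmaFactor u (ω.1 : ℂ) - 1) ?_
    (summable_sigmaFactor L u)
  · simpa [sigmaProd] using h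
  · intro ω h
    rw [add_sub_cancel, sigmaFactor_eq_zero_iff (lattice_coe_ne_zero ω)] at h
    rcases hu with hu | hu
    · exact hu (h ▸ ω.1.2)
    · exact lattice_coe_ne_zero ω (h ▸ hu)

lemma tendstoLocallyUniformlyOn_sigmaProd (L : PeriodPair) (R : ℝ) :
    TendstoLocallyUniformlyOn
      (fun (F : Finset {ω : L.lattice // ω ≠ 0}) u ↦ ∏ ω ∈ F, sigmaFactor u (ω.1 : ℂ))
      (sigmaProd L) atTop (Metric.ball 0 R) := by
  rw [show sigmaProd L = fun u ↦ ∏' ω : {ω : L.lattice // ω ≠ 0}, sigmaFactor u (ω.1 : ℂ) from rfl,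
    ← hasProdLocallyUniformlyOn_iff_tendstoLocallyUniformlyOn]
  have hfr : Module.finrank ℤ L.lattice < 3 := by simp
  have hs := ((ZLattice.summable_norm_pow_inv L.lattice 3 hfr).comp_injective
    (Subtype.val_injective (p := fun ω : L.lattice ↦ ω ≠ 0))).mul_left (R ^ 3)
  have hev : ∀ᶠ ω : {ω : L.lattice // ω ≠ 0} in cofinite, R ^ 3 * ‖ω.1‖⁻¹ ^ 3 < 1 / 8 :=
    hs.tendsto_cofinite_zero.eventually_lt_const (by norm_num)
  have h := Summable.hasProdLocallyUniformlyOn_one_add (K := Metric.ball (0 : ℂ) R)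
    (f := fun (ω : {ω : L.lattice // ω ≠ 0}) u ↦ sigmaFactor u (ω.1 : ℂ) - 1)
    Metric.isOpen_ball (hs.mul_left 2) ?_ ?_
  · simpa using h
  · filter_upwards [hev] with ω hω u hu
    have hu' : ‖u‖ < R := by simpa using hu
    have e : ‖u / (ω.1 : ℂ)‖ ^ 3 ≤ R ^ 3 * ‖ω.1‖⁻¹ ^ 3 := by
      have hR : 0 ≤ R := (norm_nonneg u).trans hu'.le
      rw [norm_div, div_eq_mul_inv, mul_pow]
      exact mul_le_mul (pow_le_pow_left₀ (norm_nonneg _) hu'.le 3) le_rfl (by positivity)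
        (by positivity)
    refine (norm_sigmaFactor_sub_one_le ?_).trans (by simp only [Function.comp_apply]; linarith)
    by_contra! hc
    have : (1 / 2 : ℝ) ^ 3 < ‖u / (ω.1 : ℂ)‖ ^ 3 := by gcongr
    norm_num only at this
    linarith
  · intro ω
    exact ((differentiable_sigmaFactor _).continuous.sub continuous_const).continuousOn

lemma differentiable_sigmaProd (L : PeriodPair) : Differentiable ℂ (sigmaProd L) := by
  intro u
  refine ((tendstoLocallyUniformlyOn_sigmaProd L (‖u‖ + 1)).differentiableOn
    (.of_forall fun F ↦ ?_) Metric.isOpen_ball).differentiableAt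
    (Metric.isOpen_ball.mem_nhds (by simp))
  exact (Differentiable.fun_finsetProd fun ω _ ↦ differentiable_sigmaFactor _).differentiableOn

lemma differentiable_sigma (L : PeriodPair) : Differentiable ℂ (sigma L) :=
  differentiable_id.mul (differentiable_sigmaProd L)

lemma sigma_eq_zero_iff (L : PeriodPair) (u : ℂ) : sigma L u = 0 ↔ u ∈ L.lattice := by
  rw [sigma_eq_mul_sigmaProd]
  constructor
  · intro h
    by_contra hu
    rcases mul_eq_zero.mp h with h | h
    · exact hu (h ▸ zero_mem _)
    · exact sigmaProd_ne_zero (.inl hu) h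
  · intro h
    by_cases h0 : u = 0
    · simp [h0]
    · have : sigmaProd L u = 0 := by
        apply tprod_of_exists_eq_zero
        refine ⟨⟨⟨u, h⟩, by simpa using h0⟩, ?_⟩
        rw [sigmaFactor_eq_zero_iff h0]
      rw [this, mul_zero]

lemma sigma_neg (L : PeriodPair) (u : ℂ) : sigma L (-u) = -sigma L u := by
  have : sigmaProd L (-u) = sigmaProd L u := by
    rw [sigmaProd, sigmaProd,
      ← ((Equiv.neg L.lattice).subtypeEquiv (p := (· ≠ 0)) (q := (· ≠ 0)) (by simp)).tprod_eq]
    refine tprod_congr fun ω ↦ ?_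
    simp [sigmaFactor]
  rw [sigma_eq_mul_sigmaProd, sigma_eq_mul_sigmaProd, this, neg_mul]

lemma deriv_sigma_zero_ne_zero (L : PeriodPair) : deriv (sigma L) 0 ≠ 0 := by
  have h : HasDerivAt (sigma L) (1 * sigmaProd L 0 + 0 * deriv (sigmaProd L) 0) 0 :=
    (hasDerivAt_id 0).mul (differentiable_sigmaProd L 0).hasDerivAt
  rw [h.deriv]
  simpa using sigmaProd_ne_zero (.inr rfl)

lemma deriv_logDeriv {f : ℂ → ℂ} (hf : Differentiable ℂ f) {u : ℂ} (hu : f u ≠ 0) :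
    deriv (logDeriv f) u = (deriv (deriv f) u * f u - deriv f u ^ 2) / f u ^ 2 := by
  have h2 : DifferentiableAt ℂ (deriv f) u := (hf.deriv) u
  unfold logDeriv
  rw [deriv_div h2 (hf u) hu]
  ring

lemma logDeriv_sigmaFactor {u ω : ℂ} (hω : ω ≠ 0) (hu : u ≠ ω) :
    logDeriv (fun u ↦ sigmaFactor u ω) u = -1 / (ω - u) + 1 / ω + u / ω ^ 2 := by
  have h1 : (1 - u / ω) ≠ 0 := by
    intro h
    apply hu
    field_simp at h
    linear_combination -h
  have h2 : HasDerivAt (fun u ↦ 1 - u / ω) (-(1 / ω)) u := by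
    simpa using ((hasDerivAt_id u).div_const ω).const_sub 1
  have h3 : HasDerivAt (fun u ↦ u / ω + u ^ 2 / (2 * ω ^ 2)) (1 / ω + u / ω ^ 2) u := by
    convert! ((hasDerivAt_id u).div_const ω).add ((hasDerivAt_pow 2 u).div_const (2 * ω ^ 2))
      using 1
    field_simp
    simp
    ring
  have h4 := h2.mul h3.cexp
  have h5 : (fun u ↦ sigmaFactor u ω) = fun u ↦
    (1 - u / ω) * Complex.exp (u / ω + u ^ 2 / (2 * ω ^ 2)) := rfl
  rw [logDeriv_apply, h5]
  rw [show deriv (fun u ↦ (1 - u / ω) * Complex.exp (u / ω + u ^ 2 / (2 * ω ^ 2))) u = _ from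
    h4.deriv, sigmaFactor]
  have := Complex.exp_ne_zero (u / ω + u ^ 2 / (2 * ω ^ 2))
  have h6 : ω - u ≠ 0 := sub_ne_zero.mpr hu.symm
  field_simp
  ring

lemma deriv_logDeriv_sigmaFactor {u ω : ℂ} (hω : ω ≠ 0) (hu : u ≠ ω) :
    deriv (logDeriv fun u ↦ sigmaFactor u ω) u = -(1 / (u - ω) ^ 2 - 1 / ω ^ 2) := by
  have hev : (logDeriv fun u ↦ sigmaFactor u ω) =ᶠ[𝓝 u]
      fun u ↦ -1 / (ω - u) + 1 / ω + u / ω ^ 2 := by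
    filter_upwards [isOpen_ne.mem_nhds hu] with v hv using logDeriv_sigmaFactor hω hv
  rw [hev.deriv_eq]
  have h6 : ω - u ≠ 0 := sub_ne_zero.mpr hu.symm
  have h1 : HasDerivAt (fun u ↦ -1 / (ω - u) + 1 / ω + u / ω ^ 2)
      (-1 / (ω - u) ^ 2 + 1 / ω ^ 2) u := by
    have ha := ((hasDerivAt_const u (-1 : ℂ)).div ((hasDerivAt_id u).const_sub ω) h6)
    convert! (ha.add_const (1 / ω)).add ((hasDerivAt_id u).div_const (ω ^ 2)) using 1
    simp
  rw [h1.deriv]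
  have h7 : u - ω ≠ 0 := sub_ne_zero.mpr hu
  rw [show (ω - u) ^ 2 = (u - ω) ^ 2 by ring]
  ring

lemma deriv_logDeriv_sigmaProd {L : PeriodPair} {u : ℂ} (hu : u ∉ L.lattice) :
    deriv (logDeriv (sigmaProd L)) u = -(L.weierstrassPExcept 0 u) := by
  set p : Finset {ω : L.lattice // ω ≠ 0} → ℂ → ℂ :=
    fun F u ↦ ∏ ω ∈ F, sigmaFactor u (ω.1 : ℂ) with hp
  have hne : ∀ ω : {ω : L.lattice // ω ≠ 0}, u ≠ ω.1 := fun ω h ↦ hu (h ▸ ω.1.2)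
  have hpd : ∀ F, Differentiable ℂ (p F) := fun F ↦
    Differentiable.fun_finsetProd fun ω _ ↦ differentiable_sigmaFactor _
  have hmem : u ∈ Metric.ball (0 : ℂ) (‖u‖ + 1) := by simp
  have t0 := tendstoLocallyUniformlyOn_sigmaProd L (‖u‖ + 1)
  have t1 := t0.deriv (.of_forall fun F ↦ (hpd F).differentiableOn) Metric.isOpen_ball
  have t2 := t1.deriv (.of_forall fun F ↦ ((hpd F).deriv).differentiableOn)
    Metric.isOpen_ball
  have h0 := t0.tendsto_at hmem
  have h1 := t1.tendsto_at hmem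
  have h2 := t2.tendsto_at hmem
  have hP : sigmaProd L u ≠ 0 := sigmaProd_ne_zero (.inl hu)
  have hlim : Tendsto (fun F ↦ deriv (logDeriv (p F)) u) atTop
      (𝓝 (deriv (logDeriv (sigmaProd L)) u)) := by
    rw [deriv_logDeriv (differentiable_sigmaProd L) hP]
    refine (((h2.mul h0).sub (h1.pow 2)).div (h0.pow 2) (pow_ne_zero 2 hP)).congr fun F ↦ ?_
    rw [deriv_logDeriv (hpd F)]
    · rfl
    · exact prod_ne_zero_iff.mpr fun ω _ ↦
        (sigmaFactor_eq_zero_iff (lattice_coe_ne_zero ω)).not.mpr (hne ω)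
  have hsum : HasSum (fun ω : {ω : L.lattice // ω ≠ 0} ↦
      -(1 / (u - (ω.1 : ℂ)) ^ 2 - 1 / (ω.1 : ℂ) ^ 2)) (-(L.weierstrassPExcept 0 u)) := by
    refine HasSum.neg ?_
    have := L.hasSum_weierstrassPExcept 0 u
    rw [← hasSum_subtype_iff_of_support_subset (s := {ω | ω ≠ 0})] at this
    · refine this.congr_fun ?_ |> fun h ↦ h
      intro ω
      simp [show (ω : L.lattice) ≠ 0 from ω.2]
    · intro ω h h0
      apply h
      simp [h0]
  refine tendsto_nhds_unique hlim (Tendsto.congr (fun F ↦ ?_) hsum)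
  have hev : logDeriv (p F) =ᶠ[𝓝 u]
      fun v ↦ ∑ ω ∈ F, logDeriv (fun v ↦ sigmaFactor v (ω.1 : ℂ)) v := by
    filter_upwards [L.isClosed_lattice.isOpen_compl.mem_nhds hu] with v hv
    rw [hp]
    refine logDeriv_prod (fun ω _ ↦ ?_) fun ω _ ↦ differentiable_sigmaFactor _ _
    exact (sigmaFactor_eq_zero_iff (lattice_coe_ne_zero ω)).not.mpr fun h ↦ hv (h ▸ ω.1.2)
  rw [hev.deriv_eq, deriv_fun_sum]
  · exact sum_congr rfl fun ω _ ↦ (deriv_logDeriv_sigmaFactor (lattice_coe_ne_zero ω) (hne ω)).symm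
  · intro ω _
    unfold logDeriv
    refine DifferentiableAt.div ((differentiable_sigmaFactor _).deriv _)
      (differentiable_sigmaFactor _ _) ?_
    exact (sigmaFactor_eq_zero_iff (lattice_coe_ne_zero ω)).not.mpr (hne ω)

lemma deriv_logDeriv_sigma {L : PeriodPair} {u : ℂ} (hu : u ∉ L.lattice) :
    deriv (logDeriv (sigma L)) u = -(L.weierstrassP u) := by
  have hev : logDeriv (sigma L) =ᶠ[𝓝 u] fun v ↦ v⁻¹ + logDeriv (sigmaProd L) v := by
    filter_upwards [L.isClosed_lattice.isOpen_compl.mem_nhds hu] with v hv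
    have h0 : v ≠ 0 := fun h ↦ hv (h ▸ zero_mem L.lattice)
    have := logDeriv_mul (f := fun v : ℂ ↦ v) (g := sigmaProd L) v h0 (sigmaProd_ne_zero (.inl hv))
      differentiableAt_id (differentiable_sigmaProd L v)
    rw [logDeriv_id', one_div] at this
    exact this
  have h0 : u ≠ 0 := fun h ↦ hu (h ▸ zero_mem L.lattice)
  have hd : DifferentiableAt ℂ (logDeriv (sigmaProd L)) u :=
    DifferentiableAt.div ((differentiable_sigmaProd L).deriv u) (differentiable_sigmaProd L u)
      (sigmaProd_ne_zero (.inl hu))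
  rw [hev.deriv_eq, deriv_fun_add (differentiableAt_inv h0) hd, deriv_logDeriv_sigmaProd hu,
    ← L.weierstrassPExcept_add 0 u]
  simp

lemma isPreconnected_compl_lattice (L : PeriodPair) : IsPreconnected (L.lattice : Set ℂ)ᶜ :=
  (Set.Countable.isConnected_compl_of_one_lt_rank (by simp)
    (countable_of_Lindelof_of_discrete (X := L.lattice))).isPreconnected

lemma exists_sigma_add (L : PeriodPair) {ω : ℂ} (hω : ω ∈ L.lattice) :
    ∃ α C : ℂ, ∀ u, sigma L (u + ω) = C * Complex.exp (α * u) * sigma L u := by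
  have hopen : IsOpen (L.lattice : Set ℂ)ᶜ := L.isClosed_lattice.isOpen_compl
  have hadd : ∀ u, u + ω ∈ L.lattice ↔ u ∈ L.lattice := fun u ↦
    L.lattice.add_mem_iff_left hω
  have hσ : ∀ u, u ∉ L.lattice → sigma L u ≠ 0 := fun u ↦ (sigma_eq_zero_iff L u).not.mpr
  have hld : ∀ u, u ∉ L.lattice → DifferentiableAt ℂ (logDeriv (sigma L)) u := fun u hu ↦
    DifferentiableAt.div ((differentiable_sigma L).deriv u) (differentiable_sigma L u) (hσ u hu)
  have hd1 : DifferentiableOn ℂ (fun u ↦ logDeriv (sigma L) (u + ω) - logDeriv (sigma L) u)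
      (L.lattice : Set ℂ)ᶜ := by
    intro u hu
    refine (DifferentiableAt.sub ?_ (hld u hu)).differentiableWithinAt
    exact DifferentiableAt.comp u (hld _ ((hadd u).not.mpr hu))
      (differentiableAt_id.add_const ω)
  obtain ⟨α, hα⟩ : ∃ α, ∀ u ∈ (L.lattice : Set ℂ)ᶜ,
      logDeriv (sigma L) (u + ω) - logDeriv (sigma L) u = α := by
    refine hopen.exists_is_const_of_deriv_eq_zero (isPreconnected_compl_lattice L) hd1 ?_
    intro u hu
    have hs : DifferentiableAt ℂ (fun u ↦ logDeriv (sigma L) (u + ω)) u :=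
      DifferentiableAt.comp u (hld _ ((hadd u).not.mpr hu)) (differentiableAt_id.add_const ω)
    rw [deriv_fun_sub hs (hld u hu), deriv_comp_add_const,
      deriv_logDeriv_sigma ((hadd u).not.mpr hu), deriv_logDeriv_sigma hu,
      L.weierstrassP_add_coe u ⟨ω, hω⟩]
    simp
  have hdshift : Differentiable ℂ fun u ↦ sigma L (u + ω) :=
    (differentiable_sigma L).comp (differentiable_id.add_const ω)
  have hdexp : Differentiable ℂ fun u ↦ Complex.exp (α * u) := by fun_prop
  have key : Set.EqOn (logDeriv fun u ↦ sigma L (u + ω))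
      (logDeriv fun u ↦ Complex.exp (α * u) * sigma L u) (L.lattice : Set ℂ)ᶜ := by
    intro u hu
    rw [logDeriv_mul (f := fun u ↦ Complex.exp (α * u)) u (Complex.exp_ne_zero _) (hσ u hu)
      (hdexp u) (differentiable_sigma L u)]
    have h1 : logDeriv (fun u ↦ Complex.exp (α * u)) u = α := by
      have : HasDerivAt (fun u ↦ Complex.exp (α * u)) (Complex.exp (α * u) * α) u := by
        simpa using ((hasDerivAt_id u).const_mul α).cexp
      rw [logDeriv_apply, this.deriv, mul_div_cancel_left₀ _ (Complex.exp_ne_zero _)]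
    rw [h1, ← hα u hu, logDeriv_apply, deriv_comp_add_const, ← logDeriv_apply, sub_add_cancel]
  rw [logDeriv_eqOn_iff (g := fun u ↦ Complex.exp (α * u) * sigma L u) hdshift.differentiableOn
    (hdexp.mul (differentiable_sigma L)).differentiableOn hopen (isPreconnected_compl_lattice L)
    (fun u hu ↦ mul_ne_zero (Complex.exp_ne_zero _) (hσ u hu))
    (fun u hu ↦ hσ _ ((hadd u).not.mpr hu))] at key
  obtain ⟨C, -, hC⟩ := key
  refine ⟨α, C, fun u ↦ ?_⟩
  by_cases hu : u ∈ L.lattice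
  · rw [(sigma_eq_zero_iff L u).mpr hu, (sigma_eq_zero_iff L _).mpr ((hadd u).mpr hu), mul_zero]
  · have := hC hu
    simpa [mul_assoc] using this

/-- The properties of the function `[u]` on which the duality rests: an odd entire function with
simple zeros at the points of a lattice, and quasi-periodic with respect to it. -/
structure IsSigmaLike (L : PeriodPair) (e : ℂ → ℂ) : Prop where
  differentiable : Differentiable ℂ e
  neg : ∀ u, e (-u) = -e u
  eq_zero_iff : ∀ u, e u = 0 ↔ u ∈ L.lattice
  deriv_ne_zero : deriv e 0 ≠ 0
  exists_add : ∀ ω ∈ L.lattice, ∃ α C : ℂ, ∀ u, e (u + ω) = C * Complex.exp (α * u) * e u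

theorem isSigmaLike_br (L : PeriodPair) (c : ℂ) : IsSigmaLike L (br L c) where
  differentiable := by
    have := differentiable_sigma L
    unfold br
    fun_prop
  neg u := by simp [br, sigma_neg]
  eq_zero_iff u := by simp [br, sigma_eq_zero_iff]
  deriv_ne_zero := by
    have h1 : Differentiable ℂ fun u ↦ Complex.exp (2 * Real.pi * Complex.I * (c * u ^ 2)) := by
      fun_prop
    have h := (h1 0).hasDerivAt.mul (differentiable_sigma L 0).hasDerivAt
    have h0 : sigma L 0 = 0 := by rw [sigma_eq_zero_iff]; exact zero_mem _
    have e : deriv (br L c) 0 = deriv (sigma L) 0 := by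
      refine h.deriv.trans ?_
      simp [h0]
    rw [e]
    exact deriv_sigma_zero_ne_zero L
  exists_add ω hω := by
    obtain ⟨α, C, h⟩ := exists_sigma_add L hω
    refine ⟨α + 2 * Real.pi * Complex.I * c * 2 * ω,
      C * Complex.exp (2 * Real.pi * Complex.I * (c * ω ^ 2)), fun u ↦ ?_⟩
    rw [br, br, h, add_mul, Complex.exp_add, show 2 * Real.pi * Complex.I * (c * (u + ω) ^ 2) =
      2 * Real.pi * Complex.I * (c * u ^ 2) + 2 * Real.pi * Complex.I * c * 2 * ω * u +
      2 * Real.pi * Complex.I * (c * ω ^ 2) by ring, Complex.exp_add, Complex.exp_add]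
    ring

/-- A meromorphic function which is periodic with respect to a lattice and has only removable
singularities is constant. -/
theorem eq_of_periodic_of_removable {L : PeriodPair} {f : ℂ → ℂ} (hf : ∀ x, MeromorphicAt f x)
    (hlim : ∀ x₀, Tendsto (fun x ↦ (x - x₀) * f x) (𝓝[≠] x₀) (𝓝 0))
    (hper : ∀ x, ∀ ω ∈ L.lattice, f (x + ω) = f x) {x y : ℂ}
    (hx : ContinuousAt f x) (hy : ContinuousAt f y) : f x = f y := by
  set g : ℂ → ℂ := fun x ↦ limUnder (𝓝[≠] x) f with hg
  have hgf : ∀ {x}, ContinuousAt f x → g x = f x := fun {x} h ↦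
    Tendsto.limUnder_eq (h.tendsto.mono_left nhdsWithin_le_nhds)
  have hdiff : Differentiable ℂ g := by
    intro x₀
    have hs : {x | AnalyticAt ℂ f x} ∈ 𝓝[≠] x₀ := (hf x₀).eventually_analyticAt
    have ho : (fun z ↦ f z - f x₀) =o[𝓝[≠] x₀] fun z ↦ (z - x₀)⁻¹ := by
      rw [Asymptotics.isLittleO_iff_tendsto']
      · have h1 : Tendsto (fun z ↦ (z - x₀) * f x₀) (𝓝[≠] x₀) (𝓝 0) := by
          have : ContinuousAt (fun z ↦ (z - x₀) * f x₀) x₀ := by fun_prop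
          simpa using this.tendsto.mono_left nhdsWithin_le_nhds
        refine (by simpa using (hlim x₀).sub h1 : Tendsto _ _ _).congr fun z ↦ ?_
        rw [div_inv_eq_mul]
        ring
      · filter_upwards [self_mem_nhdsWithin] with z hz h
        exact absurd (sub_eq_zero.mp (inv_eq_zero.mp h)) hz
    have h := Complex.differentiableOn_update_limUnder_insert_of_isLittleO hs
      (fun x hx ↦ (AnalyticAt.differentiableAt hx).differentiableWithinAt) ho
    have hn : insert x₀ {x | AnalyticAt ℂ f x} ∈ 𝓝 x₀ := insert_mem_nhds_iff.mpr hs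
    refine ((h.differentiableAt hn).congr_of_eventuallyEq ?_)
    filter_upwards [hn] with x hx
    by_cases hxx : x = x₀
    · simp [hxx, hg]
    · rw [Function.update_of_ne hxx]
      exact hgf (AnalyticAt.continuousAt (hx.resolve_left hxx))
  have hgper : ∀ z w, w ∈ L.lattice → g (z + w) = g z := by
    intro z w hw
    have hmap : map (fun x ↦ x + w) (𝓝[≠] z) = 𝓝[≠] (z + w) := by
      simp
    simp only [hg, limUnder, ← hmap, Filter.map_map]
    congr 2
    ext x
    exact hper x w hw
  rw [← hgf hx, ← hgf hy]
  exact hdiff.apply_eq_apply_of_bounded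
    (IsZLattice.isCompact_range_of_periodic L.lattice _ hdiff.continuous hgper).isBounded x y

namespace IsSigmaLike

variable {L : PeriodPair} {e : ℂ → ℂ}

lemma ne_zero_iff (he : IsSigmaLike L e) (u : ℂ) : e u ≠ 0 ↔ u ∉ L.lattice :=
  (he.eq_zero_iff u).not

lemma map_zero (he : IsSigmaLike L e) : e 0 = 0 := (he.eq_zero_iff 0).mpr (zero_mem _)

lemma sub_comm (he : IsSigmaLike L e) (u v : ℂ) : e (u - v) = -e (v - u) := by
  rw [← he.neg, neg_sub]

lemma exists_multiplier (he : IsSigmaLike L e) {ω : ℂ} (hω : ω ∈ L.lattice) :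
    ∃ α C : ℂ, C ^ 2 = Complex.exp (α * ω) ∧ ∀ u, e (u + ω) = C * Complex.exp (α * u) * e u := by
  obtain ⟨α, C, h⟩ := he.exists_add ω hω
  refine ⟨α, C, ?_, h⟩
  have hu : e (L.ω₁ / 2) ≠ 0 := (he.ne_zero_iff _).mpr L.ω₁_div_two_notMem_lattice
  set u := L.ω₁ / 2
  have h1 := h (-u - ω)
  rw [sub_add_cancel, he.neg, show -u - ω = -(u + ω) by ring, he.neg, h,
    show α * -(u + ω) = -(α * u) + -(α * ω) by ring, Complex.exp_add, Complex.exp_neg,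
    Complex.exp_neg] at h1
  have h2 := Complex.exp_ne_zero (α * u)
  have h3 := Complex.exp_ne_zero (α * ω)
  field_simp at h1
  linear_combination h1

lemma tendsto_sub_div (he : IsSigmaLike L e) (x₀ : ℂ) :
    Tendsto (fun x ↦ (x - x₀) / e (x - x₀)) (𝓝[≠] x₀) (𝓝 (deriv e 0)⁻¹) := by
  have h : HasDerivAt (fun x ↦ e (x - x₀)) (deriv e 0) x₀ := by
    have : HasDerivAt e (deriv e 0) (x₀ - x₀) := by
      rw [sub_self]; exact (he.differentiable 0).hasDerivAt
    exact this.comp_sub_const x₀ x₀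
  refine ((hasDerivAt_iff_tendsto_slope.mp h).inv₀ he.deriv_ne_zero).congr fun x ↦ ?_
  rw [slope_def_field, sub_self, he.map_zero, sub_zero, inv_div]

lemma exists_tendsto_sub_div_two_mul (he : IsSigmaLike L e) {x₀ : ℂ}
    (hx₀ : 2 * x₀ ∈ L.lattice) :
    ∃ l, Tendsto (fun x ↦ (x - x₀) / e (2 * x)) (𝓝[≠] x₀) (𝓝 l) := by
  obtain ⟨α, C, hC, h⟩ := he.exists_multiplier hx₀
  have hC0 : C ≠ 0 := by
    rintro rfl
    exact Complex.exp_ne_zero (α * (2 * x₀)) (by simpa using hC.symm)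
  have h1 : HasDerivAt (fun x ↦ e (2 * x)) (C * deriv e 0 * 2) x₀ := by
    have h2 : HasDerivAt e (C * deriv e 0) (2 * x₀) := by
      have h3 : HasDerivAt (fun u ↦ e (u - 2 * x₀)) (deriv e 0) (2 * x₀) := by
        have : HasDerivAt e (deriv e 0) (2 * x₀ - 2 * x₀) := by
          rw [sub_self]; exact (he.differentiable 0).hasDerivAt
        exact this.comp_sub_const _ _
      have h4 : HasDerivAt (fun u ↦ C * Complex.exp (α * (u - 2 * x₀)))
          (C * (Complex.exp (α * (2 * x₀ - 2 * x₀)) * (α * 1))) (2 * x₀) :=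
        ((((hasDerivAt_id (2 * x₀)).sub_const _).const_mul α).cexp).const_mul C
      have h5 := h4.mul h3
      simp only [sub_self, mul_zero, Complex.exp_zero, he.map_zero, zero_add, mul_one] at h5
      refine h5.congr_of_eventuallyEq (.of_forall fun u ↦ ?_)
      have := h (u - 2 * x₀)
      rwa [sub_add_cancel] at this
    have h6 : HasDerivAt (fun x : ℂ ↦ 2 * x) 2 x₀ := by
      simpa using (hasDerivAt_id x₀).const_mul (2 : ℂ)
    exact HasDerivAt.comp x₀ h2 h6
  refine ⟨_, ((hasDerivAt_iff_tendsto_slope.mp h1).inv₀ (mul_ne_zero (mul_ne_zero hC0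
    he.deriv_ne_zero) two_ne_zero)).congr fun x ↦ ?_⟩
  rw [slope_def_field, (he.eq_zero_iff _).mpr hx₀, sub_zero, inv_div]

end IsSigmaLike

section Factors

variable (e : ℂ → ℂ) (δ : ℂ)

/-- The product `[p ± y] = [p + y] [p - y]`. -/
def pm (p y : ℂ) : ℂ := e (p + y) * e (p - y)

/-- The quotient `[p + δ/2 ± y] / [p ± y]`. -/
def shiftRatio (p y : ℂ) : ℂ := pm e (p + δ / 2) y / pm e p y

/-- The interaction of two variables `x`, `y` of the same kind carrying the signs `s`, `t`,
where the sign `0` means that the variable is not shifted. -/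
def pairFactor (s t : SignType) (x y : ℂ) : ℂ :=
  if s = 0 then (if t = 0 then 1 else shiftRatio e δ (t * y) x)
  else if t = 0 then shiftRatio e δ (s * x) y else e (s * x + t * y + δ) / e (s * x + t * y)

/-- The interaction of a variable `x` with sign `s` and a variable `w` of the other kind. -/
def crossFactor (s : SignType) (x w : ℂ) : ℂ :=
  if s = 0 then 1 else (shiftRatio e δ (s * x) w)⁻¹

/-- The function `∏_p [x + a_p] / [2x]`. -/
def boundary (a : Fin 4 → ℂ) (x : ℂ) : ℂ := (∏ p, e (x + a p)) / e (2 * x)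

/-- The factor of a single variable `x` with sign `s`, where `q` is a formal weight. -/
def boundaryFactor (a : Fin 4 → ℂ) (q : ℂ) (s : SignType) (x : ℂ) : ℂ :=
  if s = 0 then 1 else q * boundary e a (s * x)

end Factors

section Configurations

variable {ι : Type*} [Fintype ι] [DecidableEq ι]

/-- The assignments of signs to the elements of `A`, extended by `0`. -/
def configs (A : Finset ι) : Finset (ι → SignType) :=
  Fintype.piFinset fun i ↦ if i ∈ A then univ else {0}

lemma mem_configs {A : Finset ι} {s : ι → SignType} : s ∈ configs A ↔ ∀ i ∉ A, s i = 0 := by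
  simp only [configs, Fintype.mem_piFinset]
  refine forall_congr' fun i ↦ ?_
  by_cases h : i ∈ A <;> simp [h]

lemma sum_configs_insert {A : Finset ι} {i : ι} (hi : i ∉ A) (f : (ι → SignType) → ℂ) :
    ∑ s ∈ configs (insert i A), f s =
      ∑ s ∈ configs A, ∑ ε : SignType, f (Function.update s i ε) := by
  rw [← sum_product']
  refine sum_bij' (fun s _ ↦ (Function.update s i 0, s i))
    (fun p _ ↦ Function.update p.1 i p.2) ?_ ?_ ?_ ?_ ?_
  · intro s hs
    simp only [mem_product, mem_univ, and_true, mem_configs] at hs ⊢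
    intro j hj
    by_cases hji : j = i
    · simp [hji]
    · rw [Function.update_of_ne hji]
      exact hs j (by simp [hji, hj])
  · intro p hp
    simp only [mem_product, mem_univ, and_true, mem_configs] at hp ⊢
    intro j hj
    rw [mem_insert, not_or] at hj
    rw [Function.update_of_ne hj.1]
    exact hp j hj.2
  · simp
  · intro p hp
    simp only [mem_product, mem_univ, and_true, mem_configs] at hp
    ext j
    · by_cases hji : j = i
      · subst hji; simp [hp _ hi]
      · simp [Function.update_of_ne hji]
    · simp
  · simp

lemma configs_empty : configs (∅ : Finset ι) = {0} := by
  ext s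
  simp [mem_configs, funext_iff]

end Configurations

section Sums

variable (e : ℂ → ℂ) (δ : ℂ) (a : Fin 4 → ℂ) (q : ℂ)
variable {ι : Type*} [LinearOrder ι]

/-- All the factors which involve an additional variable `x` with sign `ε`. -/
def localFactor (A B : Finset ι) (z w : ι → ℂ) (s : ι → SignType) (ε : SignType) (x : ℂ) : ℂ :=
  boundaryFactor e a q ε x * (∏ l ∈ A, pairFactor e δ ε (s l) x (z l)) *
    ∏ k ∈ B, crossFactor e δ ε x (w k)

/-- The summand attached to an assignment of signs. -/
def configTerm (A B : Finset ι) (z w : ι → ℂ) (s : ι → SignType) : ℂ :=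
  (∏ i ∈ A, boundaryFactor e a q (s i) (z i)) *
    (∏ i ∈ A, ∏ j ∈ A with i < j, pairFactor e δ (s i) (s j) (z i) (z j)) *
    ∏ i ∈ A, ∏ k ∈ B, crossFactor e δ (s i) (z i) (w k)

/-- The sum over all assignments of signs to the elements of `A`. -/
def configSum [Fintype ι] (A B : Finset ι) (z w : ι → ℂ) : ℂ :=
  ∑ s ∈ configs A, configTerm e δ a q A B z w s

variable {e δ a q}

lemma pairFactor_comm (s t : SignType) (x y : ℂ) :
    pairFactor e δ s t x y = pairFactor e δ t s y x := by
  unfold pairFactor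
  split_ifs <;> simp [add_comm]

lemma prod_lt_insert {M : Type*} [CommMonoid M] {A : Finset ι} {i : ι} (hi : i ∉ A)
    {f : ι → ι → M} (hf : ∀ i j, f i j = f j i) :
    ∏ j ∈ insert i A, ∏ k ∈ insert i A with j < k, f j k =
      (∏ l ∈ A, f i l) * ∏ j ∈ A, ∏ k ∈ A with j < k, f j k := by
  simp only [prod_filter]
  rw [prod_insert hi, prod_insert hi, if_neg (lt_irrefl i), one_mul,
    prod_congr rfl fun j _ ↦ prod_insert hi, prod_mul_distrib, ← mul_assoc, ← prod_mul_distrib]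
  congr 1
  refine prod_congr rfl fun l hl ↦ ?_
  rcases lt_trichotomy i l with h | h | h
  · simp [h, h.not_gt]
  · exact absurd (h ▸ hl) hi
  · simp [h, h.not_gt, hf l i]

lemma configTerm_insert {A : Finset ι} {i : ι} (hi : i ∉ A) (B : Finset ι) (z w : ι → ℂ)
    (s : ι → SignType) :
    configTerm e δ a q (insert i A) B z w s =
      localFactor e δ a q A B z w s (s i) (z i) * configTerm e δ a q A B z w s := by
  unfold configTerm localFactor
  rw [prod_lt_insert hi (f := fun i j ↦ pairFactor e δ (s i) (s j) (z i) (z j))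
    fun _ _ ↦ pairFactor_comm _ _ _ _, prod_insert hi, prod_insert hi]
  ring

lemma configTerm_insert_right (A : Finset ι) {B : Finset ι} {k : ι} (hk : k ∉ B) (z w : ι → ℂ)
    (s : ι → SignType) :
    configTerm e δ a q A (insert k B) z w s =
      configTerm e δ a q A B z w s * ∏ i ∈ A, crossFactor e δ (s i) (z i) (w k) := by
  unfold configTerm
  simp only [prod_insert hk, prod_mul_distrib]
  ring

lemma configTerm_congr {A B : Finset ι} {z z' w w' : ι → ℂ} {s s' : ι → SignType}
    (hz : ∀ i ∈ A, z i = z' i) (hw : ∀ k ∈ B, w k = w' k) (hs : ∀ i ∈ A, s i = s' i) :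
    configTerm e δ a q A B z w s = configTerm e δ a q A B z' w' s' := by
  unfold configTerm
  congr 1
  · congr 1
    · exact prod_congr rfl fun i hi ↦ by rw [hz i hi, hs i hi]
    · refine prod_congr rfl fun i hi ↦ prod_congr rfl fun j hj ↦ ?_
      have hj := (mem_filter.mp hj).1
      rw [hz i hi, hs i hi, hz j hj, hs j hj]
  · refine prod_congr rfl fun i hi ↦ prod_congr rfl fun k hk ↦ ?_
    rw [hz i hi, hs i hi, hw k hk]

lemma localFactor_congr {A B : Finset ι} {z z' w w' : ι → ℂ} {s s' : ι → SignType}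
    (hz : ∀ i ∈ A, z i = z' i) (hw : ∀ k ∈ B, w k = w' k) (hs : ∀ i ∈ A, s i = s' i)
    (ε : SignType) (x : ℂ) :
    localFactor e δ a q A B z w s ε x = localFactor e δ a q A B z' w' s' ε x := by
  unfold localFactor
  rw [prod_congr rfl fun i hi ↦ by rw [hz i hi, hs i hi],
    prod_congr rfl fun k (hk : k ∈ B) ↦ by rw [hw k hk]]

lemma localFactor_insert {A : Finset ι} {i : ι} (hi : i ∉ A) (B : Finset ι) (z w : ι → ℂ)
    (s : ι → SignType) (ε : SignType) (x : ℂ) :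
    localFactor e δ a q (insert i A) B z w s ε x =
      localFactor e δ a q A B z w s ε x * pairFactor e δ ε (s i) x (z i) := by
  unfold localFactor
  rw [prod_insert hi]
  ring

lemma localFactor_insert_right (A : Finset ι) {B : Finset ι} {k : ι} (hk : k ∉ B) (z w : ι → ℂ)
    (s : ι → SignType) (ε : SignType) (x : ℂ) :
    localFactor e δ a q A (insert k B) z w s ε x =
      localFactor e δ a q A B z w s ε x * crossFactor e δ ε x (w k) := by
  unfold localFactor
  rw [prod_insert hk]
  ring

lemma localFactor_zero_sign {A B : Finset ι} {z w : ι → ℂ} {s : ι → SignType} {x : ℂ} :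
    localFactor e δ a q A B z w s 0 x = ∏ l ∈ A, pairFactor e δ 0 (s l) x (z l) := by
  simp [localFactor, boundaryFactor, crossFactor]

variable [Fintype ι]

lemma configSum_congr {A B : Finset ι} {z z' w w' : ι → ℂ}
    (hz : ∀ i ∈ A, z i = z' i) (hw : ∀ k ∈ B, w k = w' k) :
    configSum e δ a q A B z w = configSum e δ a q A B z' w' :=
  sum_congr rfl fun _ _ ↦ configTerm_congr hz hw fun _ _ ↦ rfl

lemma configTerm_insert_update {A : Finset ι} {i : ι} (hi : i ∉ A) (B : Finset ι) (z w : ι → ℂ)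
    (s : ι → SignType) (ε : SignType) :
    configTerm e δ a q (insert i A) B z w (Function.update s i ε) =
      localFactor e δ a q A B z w s ε (z i) * configTerm e δ a q A B z w s := by
  have hs : ∀ j ∈ A, Function.update s i ε j = s j := fun j hj ↦
    Function.update_of_ne (ne_of_mem_of_not_mem hj hi) _ _
  rw [configTerm_insert hi, Function.update_self,
    configTerm_congr (fun _ _ ↦ rfl) (fun _ _ ↦ rfl) hs,
    localFactor_congr (fun _ _ ↦ rfl) (fun _ _ ↦ rfl) hs]

lemma configSum_insert {A : Finset ι} {i : ι} (hi : i ∉ A) (B : Finset ι) (z w : ι → ℂ) :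
    configSum e δ a q (insert i A) B z w = ∑ s ∈ configs A, ∑ ε : SignType,
      localFactor e δ a q A B z w s ε (z i) * configTerm e δ a q A B z w s := by
  rw [configSum, sum_configs_insert hi]
  simp only [configTerm_insert_update hi]

lemma configSum_insert_right (A : Finset ι) {B : Finset ι} {k : ι} (hk : k ∉ B) (z w : ι → ℂ) :
    configSum e δ a q A (insert k B) z w = ∑ s ∈ configs A,
      configTerm e δ a q A B z w s * ∏ i ∈ A, crossFactor e δ (s i) (z i) (w k) :=
  sum_congr rfl fun _ _ ↦ configTerm_insert_right A hk _ _ _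

end Sums

section Factors

variable {L : PeriodPair} {e : ℂ → ℂ} (he : IsSigmaLike L e) {δ : ℂ} {a : Fin 4 → ℂ} {q : ℂ}

lemma pm_neg_right (p y : ℂ) : pm e p (-y) = pm e p y := by
  simp only [pm, ← sub_eq_add_neg, sub_neg_eq_add]
  ring

include he in
lemma pm_neg_left (p y : ℂ) : pm e (-p) y = pm e p y := by
  rw [pm, pm, show -p + y = -(p - y) by ring, show -p - y = -(p + y) by ring, he.neg, he.neg]
  ring

include he in
lemma pm_comm (p y : ℂ) : pm e p y = -pm e y p := by
  rw [pm, pm, show p - y = -(y - p) by ring, he.neg, add_comm p y]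
  ring

include he in
lemma pm_self (p : ℂ) : pm e p p = 0 := by simp [pm, he.map_zero]

lemma sign_mul_pm_right (s : SignType) (hs : s ≠ 0) (p y : ℂ) : pm e p (s * y) = pm e p y := by
  obtain rfl | rfl | rfl := s.trichotomy
  · simp [pm_neg_right]
  · exact absurd rfl hs
  · simp

include he in
lemma sign_mul_pm_left (s : SignType) (hs : s ≠ 0) (p y : ℂ) : pm e (s * p) y = pm e p y := by
  obtain rfl | rfl | rfl := s.trichotomy
  · simp [pm_neg_left he]
  · exact absurd rfl hs
  · simp

include he in
lemma pm_add_lattice_right {ω : ℂ} (hω : ω ∈ L.lattice) :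
    ∃ m : ℂ → ℂ, (∀ y, m y ≠ 0) ∧ ∀ p y, pm e p (y + ω) = m y * pm e p y := by
  obtain ⟨α, C, hC, h⟩ := he.exists_multiplier hω
  refine ⟨fun y ↦ C ^ 2 * Complex.exp (α * (2 * y)), fun y ↦ ?_, fun p y ↦ ?_⟩
  · rw [hC]
    exact mul_ne_zero (Complex.exp_ne_zero _) (Complex.exp_ne_zero _)
  · dsimp only
    rw [pm, pm, ← add_assoc, h, he.sub_comm p (y + ω), he.sub_comm p y,
      show y + ω - p = (y - p) + ω by ring, h,
      show α * (2 * y) = α * (p + y) + α * (y - p) by ring, Complex.exp_add]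
    ring

lemma shiftRatio_neg_right (p y : ℂ) : shiftRatio e δ p (-y) = shiftRatio e δ p y := by
  simp only [shiftRatio, pm_neg_right]

lemma sign_mul_shiftRatio_right (s : SignType) (hs : s ≠ 0) (p y : ℂ) :
    shiftRatio e δ p (s * y) = shiftRatio e δ p y := by
  simp only [shiftRatio, sign_mul_pm_right s hs]

include he in
lemma inv_shiftRatio (p y : ℂ) : (shiftRatio e δ p y)⁻¹ = shiftRatio e δ (-p - δ / 2) y := by
  rw [shiftRatio, shiftRatio, inv_div, show -p - δ / 2 + δ / 2 = -p by ring,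
    show -p - δ / 2 = -(p + δ / 2) by ring, pm_neg_left he, pm_neg_left he]

include he in
lemma shiftRatio_add_lattice_right {ω : ℂ} (hω : ω ∈ L.lattice) (p y : ℂ) :
    shiftRatio e δ p (y + ω) = shiftRatio e δ p y := by
  obtain ⟨m, hm, h⟩ := pm_add_lattice_right he hω
  rw [shiftRatio, shiftRatio, h, h, mul_div_mul_left _ _ (hm y)]

include he in
/-- The multiplier of all the factors of a summand under a translation by a period. -/
lemma exists_shift_multiplier (δ : ℂ) {ω : ℂ} (hω : ω ∈ L.lattice) :
    ∃ m : ℂ, m ≠ 0 ∧ (∀ p y, shiftRatio e δ (p + ω) y = m * shiftRatio e δ p y) ∧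
      (∀ p, e (p + ω + δ) / e (p + ω) = m * (e (p + δ) / e p)) ∧
      ∀ a : Fin 4 → ℂ, ∑ p, a p = δ → ∀ x, boundary e a (x + ω) = m * boundary e a x := by
  obtain ⟨α, C, hC, h⟩ := he.exists_multiplier hω
  have hC0 : C ≠ 0 := by
    rintro rfl
    exact Complex.exp_ne_zero (α * ω) (by simpa using hC.symm)
  refine ⟨Complex.exp (α * δ), Complex.exp_ne_zero _, fun p y ↦ ?_, fun p ↦ ?_, fun a ha x ↦ ?_⟩
  · have hpm : ∀ p, pm e (p + ω) y = C ^ 2 * Complex.exp (α * (2 * p)) * pm e p y := by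
      intro p
      rw [pm, pm, show p + ω + y = p + y + ω by ring, show p + ω - y = p - y + ω by ring, h, h,
        show α * (2 * p) = α * (p + y) + α * (p - y) by ring, Complex.exp_add]
      ring
    rw [shiftRatio, shiftRatio, show p + ω + δ / 2 = p + δ / 2 + ω by ring, hpm, hpm,
      show α * (2 * (p + δ / 2)) = α * δ + α * (2 * p) by ring, Complex.exp_add, mul_div_assoc',
      ← mul_div_mul_left _ (pm e p y) (mul_ne_zero (pow_ne_zero 2 hC0)
      (Complex.exp_ne_zero (α * (2 * p))))]
    ring_nf
  · rw [show p + ω + δ = p + δ + ω by ring, h, h, mul_div_assoc',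
      ← mul_div_mul_left _ (e p) (mul_ne_zero hC0 (Complex.exp_ne_zero (α * p))),
      show α * (p + δ) = α * p + α * δ by ring, Complex.exp_add]
    ring_nf
  · have hn : ∏ p, e (x + ω + a p) =
        C ^ 4 * (Complex.exp (α * (4 * x)) * Complex.exp (α * δ)) * ∏ p, e (x + a p) := by
      rw [← Complex.exp_add, ← ha]
      simp only [add_right_comm x ω, h, Fin.prod_univ_four, Fin.sum_univ_four]
      rw [show α * (4 * x) + α * (a 0 + a 1 + a 2 + a 3) = α * (x + a 0) + α * (x + a 1) +
        α * (x + a 2) + α * (x + a 3) by ring, Complex.exp_add, Complex.exp_add, Complex.exp_add]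
      ring
    have hd : e (2 * (x + ω)) = C ^ 4 * Complex.exp (α * (4 * x)) * e (2 * x) := by
      rw [show 2 * (x + ω) = 2 * x + ω + ω by ring, h, h,
        show C ^ 4 = C ^ 2 * Complex.exp (α * ω) by rw [← hC]; ring,
        show α * (2 * x + ω) = α * (2 * x) + α * ω by ring, Complex.exp_add,
        show α * (4 * x) = α * (2 * x) + α * (2 * x) by ring, Complex.exp_add]
      ring
    rw [boundary, boundary, hn, hd, mul_div_assoc', ← mul_div_mul_left _ (e (2 * x))
      (mul_ne_zero (pow_ne_zero 4 hC0) (Complex.exp_ne_zero (α * (4 * x))))]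
    ring_nf

lemma pairFactor_neg_left (s t : SignType) (x y : ℂ) :
    pairFactor e δ (-s) t (-x) y = pairFactor e δ s t x y := by
  unfold pairFactor
  obtain rfl | rfl | rfl := s.trichotomy <;> simp [shiftRatio_neg_right]

lemma crossFactor_neg_left (s : SignType) (x w : ℂ) :
    crossFactor e δ (-s) (-x) w = crossFactor e δ s x w := by
  unfold crossFactor
  obtain rfl | rfl | rfl := s.trichotomy <;> simp

lemma crossFactor_neg_right (s : SignType) (x w : ℂ) :
    crossFactor e δ s x (-w) = crossFactor e δ s x w := by
  simp only [crossFactor, shiftRatio_neg_right]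

include he in
lemma crossFactor_add_lattice_right {ω : ℂ} (hω : ω ∈ L.lattice) (s : SignType) (x w : ℂ) :
    crossFactor e δ s x (w + ω) = crossFactor e δ s x w := by
  simp only [crossFactor, shiftRatio_add_lattice_right he hω]

lemma boundaryFactor_neg (s : SignType) (x : ℂ) :
    boundaryFactor e a q (-s) (-x) = boundaryFactor e a q s x := by
  unfold boundaryFactor
  obtain rfl | rfl | rfl := s.trichotomy <;> simp

include he in
/-- The fusion of a pair factor and a cross factor at a resonance. -/
lemma pairFactor_mul_crossFactor {ε : SignType} (hε : ε ≠ 0) (t : SignType) {x y v : ℂ}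
    (hv : v = ε * x + δ / 2 ∨ v = -(ε * x + δ / 2)) (h : pm e (ε * x + δ) y ≠ 0) :
    pairFactor e δ ε t x y * crossFactor e δ t y v = shiftRatio e δ (ε * x) y := by
  have hc : crossFactor e δ t y v = crossFactor e δ t y (ε * x + δ / 2) := by
    rcases hv with rfl | rfl
    · rfl
    · rw [crossFactor_neg_right]
  rw [hc, pairFactor, if_neg hε, crossFactor]
  by_cases ht : t = 0
  · simp [ht]
  rw [if_neg ht, if_neg ht, ← sign_mul_shiftRatio_right t ht (ε * x) y, shiftRatio, shiftRatio, inv_div,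
    pm_comm he (t * y + δ / 2), pm_comm he (t * y)]
  rw [← sign_mul_pm_right t ht] at h
  set p := (ε : ℂ) * x
  set y' := (t : ℂ) * y
  have h1 : pm e (p + δ / 2) (y' + δ / 2) = e (p + y' + δ) * e (p - y') := by
    rw [pm]
    ring_nf
  have h2 : e (p + y' + δ) ≠ 0 := by
    rw [pm] at h
    rw [add_right_comm]
    exact left_ne_zero_of_mul h
  rw [h1, pm, pm]
  field_simp

end Factors

section Sums

variable {L : PeriodPair} {e : ℂ → ℂ} (he : IsSigmaLike L e) {δ : ℂ} {a : Fin 4 → ℂ} {q : ℂ}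
variable {ι : Type*} [LinearOrder ι]

lemma localFactor_neg (A B : Finset ι) (z w : ι → ℂ) (s : ι → SignType) (ε : SignType) (x : ℂ) :
    localFactor e δ a q A B z w s (-ε) (-x) = localFactor e δ a q A B z w s ε x := by
  simp only [localFactor, boundaryFactor_neg, pairFactor_neg_left, crossFactor_neg_left]

include he in
lemma localFactor_add_lattice {A B : Finset ι} (hAB : #B = #A + 1) (ha : ∑ p, a p = δ)
    (z w : ι → ℂ) (s : ι → SignType) (ε : SignType) (x : ℂ) {ω : ℂ} (hω : ω ∈ L.lattice) :
    localFactor e δ a q A B z w s ε (x + ω) = localFactor e δ a q A B z w s ε x := by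
  by_cases hε : ε = 0
  · subst hε
    rw [localFactor_zero_sign, localFactor_zero_sign]
    refine prod_congr rfl fun l _ ↦ ?_
    simp only [pairFactor, if_true, shiftRatio_add_lattice_right he hω]
  have hω' : (ε : ℂ) * ω ∈ L.lattice := by
    obtain rfl | rfl | rfl := ε.trichotomy
    · simpa using hω
    · simp
    · simpa using hω
  obtain ⟨m, hm, h1, h2, h3⟩ := exists_shift_multiplier he δ hω'
  have hb : boundaryFactor e a q ε (x + ω) = m * boundaryFactor e a q ε x := by
    rw [boundaryFactor, boundaryFactor, if_neg hε, if_neg hε, mul_add, h3 a ha]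
    ring
  have hp : ∀ t y, pairFactor e δ ε t (x + ω) y = m * pairFactor e δ ε t x y := by
    intro t y
    rw [pairFactor, pairFactor, if_neg hε, if_neg hε, mul_add, h1]
    split_ifs
    · rfl
    · rw [add_right_comm ((ε : ℂ) * x), h2]
  have hc : ∀ y, crossFactor e δ ε (x + ω) y = m⁻¹ * crossFactor e δ ε x y := by
    intro y
    rw [crossFactor, crossFactor, if_neg hε, if_neg hε, mul_add, h1, mul_inv]
  simp only [localFactor, hb, hp, hc, prod_mul_distrib, prod_const, hAB]
  have : m * m ^ #A * m⁻¹ ^ (#A + 1) = 1 := by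
    rw [inv_pow, ← pow_succ', mul_inv_cancel₀ (pow_ne_zero _ hm)]
  linear_combination (boundaryFactor e a q ε x * (∏ l ∈ A, pairFactor e δ ε (s l) x (z l)) *
    ∏ k ∈ B, crossFactor e δ ε x (w k)) * this

variable (e δ a q) in
/-- The sum over the signs of the elements of `A` and of one more variable `x`. -/
def leftFun [Fintype ι] (A B : Finset ι) (z w : ι → ℂ) (x : ℂ) : ℂ :=
  ∑ s ∈ configs A, ∑ ε : SignType,
    localFactor e δ a q A B z w s ε x * configTerm e δ a q A B z w s

variable (e δ a q) in
/-- The sum over the signs of the elements of `B`, with one more variable `x` of the other kind. -/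
def rightFun [Fintype ι] (A B : Finset ι) (z w : ι → ℂ) (x : ℂ) : ℂ :=
  ∑ s ∈ configs B, configTerm e δ a q B A w z s * ∏ k ∈ B, crossFactor e δ (s k) (w k) x

variable [Fintype ι]

lemma configSum_eq_leftFun {A : Finset ι} {i : ι} (hi : i ∉ A) (B : Finset ι) (z w : ι → ℂ) :
    configSum e δ a q (insert i A) B z w = leftFun e δ a q A B z w (z i) :=
  configSum_insert hi B z w

lemma configSum_eq_rightFun {A : Finset ι} {i : ι} (hi : i ∉ A) (B : Finset ι) (z w : ι → ℂ) :
    configSum e δ a q B (insert i A) w z = rightFun e δ a q A B z w (z i) :=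
  configSum_insert_right B hi w z

lemma leftFun_neg (A B : Finset ι) (z w : ι → ℂ) (x : ℂ) :
    leftFun e δ a q A B z w (-x) = leftFun e δ a q A B z w x :=
  sum_congr rfl fun s _ ↦ Fintype.sum_equiv (Equiv.neg SignType) _ _ fun ε ↦ by
    rw [Equiv.neg_apply, ← localFactor_neg A B z w s ε (-x), neg_neg]

lemma rightFun_neg (A B : Finset ι) (z w : ι → ℂ) (x : ℂ) :
    rightFun e δ a q A B z w (-x) = rightFun e δ a q A B z w x := by
  simp only [rightFun, crossFactor_neg_right]

include he in
lemma leftFun_add_lattice {A B : Finset ι} (hAB : #B = #A + 1) (ha : ∑ p, a p = δ)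
    (z w : ι → ℂ) (x : ℂ) {ω : ℂ} (hω : ω ∈ L.lattice) :
    leftFun e δ a q A B z w (x + ω) = leftFun e δ a q A B z w x := by
  simp only [leftFun, localFactor_add_lattice he hAB ha z w _ _ x hω]

include he in
lemma rightFun_add_lattice (A B : Finset ι) (z w : ι → ℂ) (x : ℂ) {ω : ℂ} (hω : ω ∈ L.lattice) :
    rightFun e δ a q A B z w (x + ω) = rightFun e δ a q A B z w x := by
  simp only [rightFun, crossFactor_add_lattice_right he hω]

/-- The sum does not depend on the sign of a variable of the second kind. -/
lemma configSum_update_neg_right (A B : Finset ι) (z w : ι → ℂ) (k : ι) :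
    configSum e δ a q A B z (Function.update w k (-w k)) = configSum e δ a q A B z w := by
  unfold configSum configTerm
  refine sum_congr rfl fun s _ ↦ ?_
  congr 1
  refine prod_congr rfl fun i _ ↦ prod_congr rfl fun l _ ↦ ?_
  by_cases h : l = k
  · rw [h, Function.update_self, crossFactor_neg_right]
  · rw [Function.update_of_ne h]

/-- The sum does not depend on the sign of a variable of the first kind. -/
lemma configSum_update_neg {A : Finset ι} {i : ι} (hi : i ∈ A) (B : Finset ι) (z w : ι → ℂ) :
    configSum e δ a q A B (Function.update z i (-z i)) w = configSum e δ a q A B z w := by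
  rw [← insert_erase hi, configSum_eq_leftFun (notMem_erase i A),
    configSum_eq_leftFun (notMem_erase i A), Function.update_self, leftFun_neg]
  have hz : ∀ j ∈ A.erase i, Function.update z i (-z i) j = z j := fun j hj ↦
    Function.update_of_ne (ne_of_mem_erase hj) _ _
  refine sum_congr rfl fun s _ ↦ sum_congr rfl fun ε _ ↦ ?_
  rw [localFactor_congr hz (fun _ _ ↦ rfl) fun _ _ ↦ rfl,
    configTerm_congr hz (fun _ _ ↦ rfl) fun _ _ ↦ rfl]

end Sums

section Regularity

variable {L : PeriodPair} {e : ℂ → ℂ} (he : IsSigmaLike L e) {δ : ℂ} {a : Fin 4 → ℂ} {q : ℂ}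

variable (e δ) in
/-- The denominators in the interaction of two variables of different kinds do not vanish. -/
def CrossRegular (x w : ℂ) : Prop := pm e (x + δ / 2) w ≠ 0 ∧ pm e (x - δ / 2) w ≠ 0

include he in
lemma CrossRegular.symm {x w : ℂ} (h : CrossRegular e δ x w) : CrossRegular e δ w x := by
  have h1 : pm e (w + δ / 2) x * pm e (w - δ / 2) x = pm e (x + δ / 2) w * pm e (x - δ / 2) w := by
    simp only [pm]
    rw [he.sub_comm (w + δ / 2), he.sub_comm (w - δ / 2)]
    ring_nf
  have h2 := mul_ne_zero h.1 h.2
  rw [← h1] at h2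
  exact ⟨left_ne_zero_of_mul h2, right_ne_zero_of_mul h2⟩

include he in
lemma CrossRegular.pm_sign {x w : ℂ} (h : CrossRegular e δ x w) {s : SignType} (hs : s ≠ 0) :
    pm e (s * x + δ / 2) w ≠ 0 := by
  obtain rfl | rfl | rfl := s.trichotomy
  · rw [← pm_neg_left he]
    convert! h.2 using 2
    simp
    ring
  · exact absurd rfl hs
  · simpa using h.1

variable {x y p : ℂ → ℂ} {t₀ : ℂ}

section Continuity

include he in
lemma continuousAt_pm (hp : ContinuousAt p t₀) (hy : ContinuousAt y t₀) :
    ContinuousAt (fun t ↦ pm e (p t) (y t)) t₀ := by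
  have := he.differentiable.continuous
  unfold pm
  fun_prop

include he in
lemma continuousAt_shiftRatio (hp : ContinuousAt p t₀) (hy : ContinuousAt y t₀)
    (h : pm e (p t₀) (y t₀) ≠ 0) : ContinuousAt (fun t ↦ shiftRatio e δ (p t) (y t)) t₀ :=
  (continuousAt_pm he (hp.add continuousAt_const) hy).div (continuousAt_pm he hp hy) h

include he in
lemma continuousAt_pairFactor (hx : ContinuousAt x t₀) (hy : ContinuousAt y t₀)
    (h : pm e (x t₀) (y t₀) ≠ 0) (s r : SignType) :
    ContinuousAt (fun t ↦ pairFactor e δ s r (x t) (y t)) t₀ := by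
  have hc := he.differentiable.continuous
  unfold pairFactor
  split_ifs with hs hr hr
  · exact continuousAt_const
  · refine continuousAt_shiftRatio he (by fun_prop) hx ?_
    rw [sign_mul_pm_left he r hr, pm_comm he]
    exact neg_ne_zero.mpr h
  · refine continuousAt_shiftRatio he (by fun_prop) hy ?_
    rwa [sign_mul_pm_left he s hs]
  · refine ContinuousAt.div (by fun_prop) (by fun_prop) ?_
    rw [← sign_mul_pm_left he s hs, ← sign_mul_pm_right r hr] at h
    exact left_ne_zero_of_mul h

include he in
lemma continuousAt_crossFactor_sign {s : SignType} (hx : ContinuousAt x t₀)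
    (hy : ContinuousAt y t₀) (h : s ≠ 0 → pm e (s * x t₀ + δ / 2) (y t₀) ≠ 0) :
    ContinuousAt (fun t ↦ crossFactor e δ s (x t) (y t)) t₀ := by
  unfold crossFactor shiftRatio
  split_ifs with hs
  · exact continuousAt_const
  · simp only [inv_div]
    exact (continuousAt_pm he (by fun_prop) hy).div (continuousAt_pm he (by fun_prop) hy) (h hs)

include he in
lemma continuousAt_crossFactor (hx : ContinuousAt x t₀) (hy : ContinuousAt y t₀)
    (h : CrossRegular e δ (x t₀) (y t₀)) (s : SignType) :
    ContinuousAt (fun t ↦ crossFactor e δ s (x t) (y t)) t₀ :=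
  continuousAt_crossFactor_sign he hx hy fun hs ↦ h.pm_sign he hs

include he in
lemma continuousAt_boundaryFactor (hx : ContinuousAt x t₀) (h : e (2 * x t₀) ≠ 0)
    (s : SignType) : ContinuousAt (fun t ↦ boundaryFactor e a q s (x t)) t₀ := by
  have hc := he.differentiable.continuous
  have hs : s ≠ 0 → e (2 * (s * x t₀)) ≠ 0 := by
    intro hs
    obtain rfl | rfl | rfl := s.trichotomy
    · simpa [he.neg] using h
    · exact absurd rfl hs
    · simpa using h
  unfold boundaryFactor boundary
  split_ifs with h0
  · exact continuousAt_const
  · exact continuousAt_const.mul (ContinuousAt.div (by fun_prop) (by fun_prop) (hs h0))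

end Continuity

section Meromorphy

include he in
lemma meromorphicAt_comp (hx : AnalyticAt ℂ x t₀) : MeromorphicAt (fun t ↦ e (x t)) t₀ :=
  ((he.differentiable.analyticAt (x t₀)).comp hx).meromorphicAt

include he in
lemma meromorphicAt_shiftRatio (hp : AnalyticAt ℂ p t₀) (hy : AnalyticAt ℂ y t₀) :
    MeromorphicAt (fun t ↦ shiftRatio e δ (p t) (y t)) t₀ := by
  unfold shiftRatio pm
  exact ((meromorphicAt_comp he (by fun_prop)).mul (meromorphicAt_comp he (by fun_prop))).div
    ((meromorphicAt_comp he (by fun_prop)).mul (meromorphicAt_comp he (by fun_prop)))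

include he in
lemma meromorphicAt_pairFactor (hx : AnalyticAt ℂ x t₀) (hy : AnalyticAt ℂ y t₀)
    (s r : SignType) : MeromorphicAt (fun t ↦ pairFactor e δ s r (x t) (y t)) t₀ := by
  unfold pairFactor
  split_ifs
  · exact MeromorphicAt.const 1 t₀
  · exact meromorphicAt_shiftRatio he (by fun_prop) hx
  · exact meromorphicAt_shiftRatio he (by fun_prop) hy
  · exact (meromorphicAt_comp he (by fun_prop)).div (meromorphicAt_comp he (by fun_prop))

include he in
lemma meromorphicAt_crossFactor (hx : AnalyticAt ℂ x t₀) (hy : AnalyticAt ℂ y t₀)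
    (s : SignType) : MeromorphicAt (fun t ↦ crossFactor e δ s (x t) (y t)) t₀ := by
  unfold crossFactor
  split_ifs
  · exact MeromorphicAt.const 1 t₀
  · exact (meromorphicAt_shiftRatio he (by fun_prop) hy).inv

include he in
lemma meromorphicAt_boundaryFactor (hx : AnalyticAt ℂ x t₀) (s : SignType) :
    MeromorphicAt (fun t ↦ boundaryFactor e a q s (x t)) t₀ := by
  unfold boundaryFactor boundary
  split_ifs
  · exact MeromorphicAt.const 1 t₀
  · refine (MeromorphicAt.const q t₀).mul (MeromorphicAt.div ?_
      (meromorphicAt_comp he (by fun_prop)))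
    simp only [Fin.prod_univ_four]
    exact (((meromorphicAt_comp he (by fun_prop)).mul (meromorphicAt_comp he (by fun_prop))).mul
      (meromorphicAt_comp he (by fun_prop))).mul (meromorphicAt_comp he (by fun_prop))

end Meromorphy

end Regularity

section Sums

variable {L : PeriodPair} {e : ℂ → ℂ} (he : IsSigmaLike L e) {δ : ℂ} {a : Fin 4 → ℂ} {q : ℂ}
variable {ι : Type*} [LinearOrder ι]

include he in
lemma continuousAt_configTerm {A B : Finset ι} {z w : ℂ → ι → ℂ} {t₀ : ℂ}
    (hz : ∀ i ∈ A, ContinuousAt (fun t ↦ z t i) t₀) (hw : ∀ k ∈ B, ContinuousAt (fun t ↦ w t k) t₀)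
    (h2 : ∀ i ∈ A, e (2 * z t₀ i) ≠ 0)
    (hzz : ∀ i ∈ A, ∀ j ∈ A, i ≠ j → pm e (z t₀ i) (z t₀ j) ≠ 0)
    (hzw : ∀ i ∈ A, ∀ k ∈ B, CrossRegular e δ (z t₀ i) (w t₀ k)) (s : ι → SignType) :
    ContinuousAt (fun t ↦ configTerm e δ a q A B (z t) (w t) s) t₀ := by
  refine ((tendsto_finsetProd A fun i hi ↦ ?_).mul (tendsto_finsetProd A fun i hi ↦
    tendsto_finsetProd _ fun j hj ↦ ?_)).mul
    (tendsto_finsetProd A fun i hi ↦ tendsto_finsetProd B fun k hk ↦ ?_)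
  · exact continuousAt_boundaryFactor he (hz i hi) (h2 i hi) _
  · have hj := mem_filter.mp hj
    exact continuousAt_pairFactor he (hz i hi) (hz j hj.1) (hzz i hi j hj.1 hj.2.ne) _ _
  · exact continuousAt_crossFactor he (hz i hi) (hw k hk) (hzw i hi k hk) _

include he in
lemma continuousAt_localFactor {A B : Finset ι} {z w : ι → ℂ} {x₀ : ℂ} (h2 : e (2 * x₀) ≠ 0)
    (hz : ∀ l ∈ A, pm e x₀ (z l) ≠ 0) (hw : ∀ k ∈ B, CrossRegular e δ x₀ (w k))
    (s : ι → SignType) (ε : SignType) :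
    ContinuousAt (localFactor e δ a q A B z w s ε) x₀ := by
  refine ((continuousAt_boundaryFactor he continuousAt_id h2 ε).mul
    (tendsto_finsetProd A fun l hl ↦ ?_)).mul (tendsto_finsetProd B fun k hk ↦ ?_)
  · exact continuousAt_pairFactor he continuousAt_id continuousAt_const (hz l hl) _ _
  · exact continuousAt_crossFactor he continuousAt_id continuousAt_const (hw k hk) _

include he in
lemma meromorphicAt_localFactor (A B : Finset ι) (z w : ι → ℂ) (x₀ : ℂ) (s : ι → SignType)
    (ε : SignType) : MeromorphicAt (localFactor e δ a q A B z w s ε) x₀ := by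
  refine ((meromorphicAt_boundaryFactor he analyticAt_id ε).mul
    (MeromorphicAt.fun_prod (s := A) fun l _ ↦ ?_)).mul
    (MeromorphicAt.fun_prod (s := B) fun k _ ↦ ?_)
  · exact meromorphicAt_pairFactor he analyticAt_id analyticAt_const _ _
  · exact meromorphicAt_crossFactor he analyticAt_id analyticAt_const _

variable [Fintype ι]

include he in
lemma continuousAt_configSum {A B : Finset ι} {z w : ℂ → ι → ℂ} {t₀ : ℂ}
    (hz : ∀ i ∈ A, ContinuousAt (fun t ↦ z t i) t₀) (hw : ∀ k ∈ B, ContinuousAt (fun t ↦ w t k) t₀)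
    (h2 : ∀ i ∈ A, e (2 * z t₀ i) ≠ 0)
    (hzz : ∀ i ∈ A, ∀ j ∈ A, i ≠ j → pm e (z t₀ i) (z t₀ j) ≠ 0)
    (hzw : ∀ i ∈ A, ∀ k ∈ B, CrossRegular e δ (z t₀ i) (w t₀ k)) :
    ContinuousAt (fun t ↦ configSum e δ a q A B (z t) (w t)) t₀ :=
  tendsto_finsetSum _ fun s _ ↦ continuousAt_configTerm he hz hw h2 hzz hzw s

include he in
lemma continuousAt_leftFun {A B : Finset ι} {z w : ι → ℂ} {x₀ : ℂ} (h2 : e (2 * x₀) ≠ 0)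
    (hz : ∀ l ∈ A, pm e x₀ (z l) ≠ 0) (hw : ∀ k ∈ B, CrossRegular e δ x₀ (w k)) :
    ContinuousAt (leftFun e δ a q A B z w) x₀ :=
  tendsto_finsetSum _ fun s _ ↦ tendsto_finsetSum _ fun ε _ ↦
    (continuousAt_localFactor he h2 hz hw s ε).mul continuousAt_const

include he in
lemma continuousAt_rightFun {A B : Finset ι} {z w : ι → ℂ} {x₀ : ℂ}
    (hw : ∀ k ∈ B, CrossRegular e δ x₀ (w k)) : ContinuousAt (rightFun e δ a q A B z w) x₀ :=
  tendsto_finsetSum _ fun _ _ ↦ continuousAt_const.mul (tendsto_finsetProd _ fun k hk ↦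
    continuousAt_crossFactor he continuousAt_const continuousAt_id ((hw k hk).symm he) _)

include he in
lemma meromorphicAt_leftFun (A B : Finset ι) (z w : ι → ℂ) (x₀ : ℂ) :
    MeromorphicAt (leftFun e δ a q A B z w) x₀ :=
  MeromorphicAt.fun_sum fun s _ ↦ MeromorphicAt.fun_sum fun ε _ ↦
    (meromorphicAt_localFactor he A B z w x₀ s ε).mul (MeromorphicAt.const _ _)

include he in
lemma meromorphicAt_rightFun (A B : Finset ι) (z w : ι → ℂ) (x₀ : ℂ) :
    MeromorphicAt (rightFun e δ a q A B z w) x₀ :=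
  MeromorphicAt.fun_sum fun _ _ ↦ (MeromorphicAt.const _ _).mul (MeromorphicAt.fun_prod fun _ _ ↦
    meromorphicAt_crossFactor he analyticAt_const analyticAt_id _)

end Sums

lemma tendsto_sub_mul_of_continuousAt {f : ℂ → ℂ} {x₀ : ℂ} (hf : ContinuousAt f x₀) :
    Tendsto (fun x ↦ (x - x₀) * f x) (𝓝[≠] x₀) (𝓝 0) := by
  have h : ContinuousAt (fun x ↦ (x - x₀) * f x) x₀ := by fun_prop
  simpa using h.tendsto.mono_left nhdsWithin_le_nhds

lemma sum_signType (f : SignType → ℂ) : ∑ ε, f ε = f 0 + f (-1) + f 1 := by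
  rw [show (univ : Finset SignType) = {0, -1, 1} from rfl]
  simp [add_assoc]

section Factors

variable {L : PeriodPair} {e : ℂ → ℂ} (he : IsSigmaLike L e) {δ : ℂ} {a : Fin 4 → ℂ} {q : ℂ}

include he in
lemma tendsto_sub_mul_of_eq_div_mul {f g : ℂ → ℂ} {y : ℂ} (hg : ContinuousAt g y)
    (hf : ∀ x, (x - y) * f x = (x - y) / e (x - y) * g x) :
    Tendsto (fun x ↦ (x - y) * f x) (𝓝[≠] y) (𝓝 ((deriv e 0)⁻¹ * g y)) := by
  rw [funext hf]
  exact (he.tendsto_sub_div y).mul (hg.tendsto.mono_left nhdsWithin_le_nhds)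

include he in
lemma tendsto_sub_mul_pairFactor_zero_right {y : ℂ} (hy : e (2 * y) ≠ 0) {s : SignType}
    (hs : s ≠ 0) :
    Tendsto (fun x ↦ (x - y) * pairFactor e δ s 0 x y) (𝓝[≠] y)
      (𝓝 ((deriv e 0)⁻¹ * (pm e (s * y + δ / 2) y / e (y + y)))) := by
  have hc := he.differentiable.continuous
  refine tendsto_sub_mul_of_eq_div_mul he
    (g := fun x ↦ pm e (s * x + δ / 2) y / e (x + y)) ?_ fun x ↦ ?_
  · refine (continuousAt_pm he (by fun_prop) (by fun_prop)).div (by fun_prop) ?_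
    rwa [← two_mul]
  · rw [pairFactor, if_neg hs, if_pos rfl, shiftRatio, sign_mul_pm_left he s hs, pm.eq_1 e x y]
    ring

include he in
lemma tendsto_sub_mul_pairFactor_zero_left {y : ℂ} (hy : e (2 * y) ≠ 0) {s : SignType}
    (hs : s ≠ 0) :
    Tendsto (fun x ↦ (x - y) * pairFactor e δ 0 s x y) (𝓝[≠] y)
      (𝓝 ((deriv e 0)⁻¹ * (-(pm e (s * y + δ / 2) y / e (y + y))))) := by
  have hc := he.differentiable.continuous
  refine tendsto_sub_mul_of_eq_div_mul he
    (g := fun x ↦ -(pm e (s * y + δ / 2) x / e (x + y))) ?_ fun x ↦ ?_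
  · refine ((continuousAt_pm he (by fun_prop) (by fun_prop)).div (by fun_prop) ?_).neg
    rwa [← two_mul]
  · rw [pairFactor, if_pos rfl, if_neg hs, shiftRatio, sign_mul_pm_left he s hs, pm_comm he y x,
      pm.eq_1 e x y]
    ring

include he in
lemma tendsto_sub_mul_pairFactor_opposite (y : ℂ) {s : SignType} (hs : s ≠ 0) :
    Tendsto (fun x ↦ (x - y) * pairFactor e δ s (-s) x y) (𝓝[≠] y)
      (𝓝 ((deriv e 0)⁻¹ * (s * e δ))) := by
  have hc := he.differentiable.continuous
  have h := tendsto_sub_mul_of_eq_div_mul he (y := y) (f := fun x ↦ pairFactor e δ s (-s) x y)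
    (g := fun x ↦ s * e (s * (x - y) + δ)) (by fun_prop) fun x ↦ ?_
  · simpa using h
  · rw [pairFactor, if_neg hs, if_neg (show ¬-s = 0 by revert s; decide), SignType.coe_neg, neg_mul,
      ← sub_eq_add_neg, ← mul_sub]
    obtain rfl | rfl | rfl := s.trichotomy
    · rw [SignType.coe_neg_one, neg_one_mul, he.neg]
      ring
    · exact absurd rfl hs
    · rw [SignType.coe_one, one_mul]
      ring

include he in
lemma tendsto_sub_mul_pairFactor_self {y : ℂ} (hy : e (2 * y) ≠ 0) (s : SignType) :
    Tendsto (fun x ↦ (x - y) * pairFactor e δ s s x y) (𝓝[≠] y) (𝓝 0) := by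
  have hc := he.differentiable.continuous
  refine tendsto_sub_mul_of_continuousAt ?_
  unfold pairFactor
  split_ifs with hs
  · exact continuousAt_const
  · refine ContinuousAt.div (by fun_prop) (by fun_prop) ?_
    obtain rfl | rfl | rfl := s.trichotomy
    · rw [← mul_add, ← two_mul, SignType.coe_neg_one, neg_one_mul, he.neg]
      exact neg_ne_zero.mpr hy
    · exact absurd rfl hs
    · rwa [← mul_add, ← two_mul, SignType.coe_one, one_mul]

include he in
/-- The residues of the interaction of two variables at the diagonal are antisymmetric. -/
lemma exists_tendsto_pairFactor {y : ℂ} (hy : e (2 * y) ≠ 0) :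
    ∃ l : SignType → SignType → ℂ, (∀ s t, l s t = -l t s) ∧
      ∀ s t, Tendsto (fun x ↦ (x - y) * pairFactor e δ s t x y) (𝓝[≠] y) (𝓝 (l s t)) := by
  refine ⟨fun s t ↦ (deriv e 0)⁻¹ * (if s = t then 0 else if s = 0 then
    -(pm e (t * y + δ / 2) y / e (y + y)) else if t = 0 then
    pm e (s * y + δ / 2) y / e (y + y) else s * e δ), ?_, ?_⟩
  · intro s t
    obtain rfl | rfl | rfl := s.trichotomy <;> obtain rfl | rfl | rfl := t.trichotomy <;> simp
  · intro s t
    by_cases hst : s = t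
    · subst hst
      simpa only [if_true, mul_zero] using tendsto_sub_mul_pairFactor_self he hy s
    by_cases hs : s = 0
    · subst hs
      simpa only [if_neg hst, if_true] using
        tendsto_sub_mul_pairFactor_zero_left he hy (Ne.symm hst)
    by_cases ht : t = 0
    · subst ht
      simpa only [if_neg hst, if_true] using tendsto_sub_mul_pairFactor_zero_right he hy hs
    have : t = -s := by revert s t; decide
    subst this
    simpa only [if_neg hst, if_neg hs, if_neg ht] using tendsto_sub_mul_pairFactor_opposite he y hs

end Factors

section Sums

variable {L : PeriodPair} {e : ℂ → ℂ} (he : IsSigmaLike L e) {δ : ℂ} {a b : Fin 4 → ℂ} {q : ℂ}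
variable {ι : Type*} [LinearOrder ι] [Fintype ι]

include he in
lemma tendsto_leftFun_of_mem {A B : Finset ι} {j : ι} (hj : j ∉ A) {z w : ι → ℂ}
    (h2 : e (2 * z j) ≠ 0) (hz : ∀ l ∈ A, pm e (z j) (z l) ≠ 0)
    (hw : ∀ k ∈ B, CrossRegular e δ (z j) (w k)) :
    Tendsto (fun x ↦ (x - z j) * leftFun e δ a q (insert j A) B z w x) (𝓝[≠] z j) (𝓝 0) := by
  obtain ⟨l, hl, hlim⟩ := exists_tendsto_pairFactor he (δ := δ) h2
  set T := configTerm e δ a q A B z w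
  set F := localFactor e δ a q A B z w
  have hexp : ∀ x, (x - z j) * leftFun e δ a q (insert j A) B z w x =
      ∑ s ∈ configs A, ∑ ε' : SignType, ∑ ε : SignType,
        F s ε x * ((x - z j) * pairFactor e δ ε ε' x (z j)) * (F s ε' (z j) * T s) := by
    intro x
    rw [leftFun, sum_configs_insert hj, mul_sum]
    refine sum_congr rfl fun s _ ↦ ?_
    rw [mul_sum]
    refine sum_congr rfl fun ε' _ ↦ ?_
    rw [mul_sum]
    refine sum_congr rfl fun ε _ ↦ ?_
    have hs : ∀ i ∈ A, Function.update s j ε' i = s i := fun i hi ↦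
      Function.update_of_ne (ne_of_mem_of_not_mem hi hj) _ _
    rw [configTerm_insert_update hj, localFactor_insert hj, Function.update_self,
      localFactor_congr (fun _ _ ↦ rfl) (fun _ _ ↦ rfl) hs]
    ring
  have hsum : ∀ s, ∑ ε' : SignType, ∑ ε : SignType,
      F s ε (z j) * l ε ε' * (F s ε' (z j) * T s) = 0 := by
    intro s
    have : ∑ ε' : SignType, ∑ ε : SignType, F s ε (z j) * l ε ε' * (F s ε' (z j) * T s) =
        -∑ ε' : SignType, ∑ ε : SignType, F s ε (z j) * l ε ε' * (F s ε' (z j) * T s) := by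
      conv_lhs => rw [sum_comm]
      simp only [← sum_neg_distrib]
      refine sum_congr rfl fun ε' _ ↦ sum_congr rfl fun ε _ ↦ ?_
      rw [hl ε' ε]
      ring
    exact self_eq_neg.mp this
  rw [funext hexp, ← sum_const_zero (s := configs A), ← sum_congr rfl fun s _ ↦ hsum s]
  refine tendsto_finsetSum _ fun s _ ↦ tendsto_finsetSum _ fun ε' _ ↦
    tendsto_finsetSum _ fun ε _ ↦ ?_
  exact (((continuousAt_localFactor he h2 hz hw s ε).tendsto.mono_left
    nhdsWithin_le_nhds).mul (hlim ε ε')).mul_const _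

include he in
lemma tendsto_leftFun_of_two_mul_mem {A B : Finset ι} (hAB : #B = #A + 1) (ha : ∑ p, a p = δ)
    {z w : ι → ℂ} {x₀ : ℂ} (h2 : 2 * x₀ ∈ L.lattice) (hz : ∀ l ∈ A, pm e x₀ (z l) ≠ 0)
    (hw : ∀ k ∈ B, CrossRegular e δ x₀ (w k)) :
    Tendsto (fun x ↦ (x - x₀) * leftFun e δ a q A B z w x) (𝓝[≠] x₀) (𝓝 0) := by
  have hc := he.differentiable.continuous
  obtain ⟨c, hc2⟩ := he.exists_tendsto_sub_div_two_mul h2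
  simp only [leftFun, mul_sum]
  rw [← sum_const_zero (s := configs A)]
  refine tendsto_finsetSum _ fun s _ ↦ ?_
  simp only [← mul_assoc, ← sum_mul]
  rw [← zero_mul (configTerm e δ a q A B z w s)]
  refine Tendsto.mul_const _ ?_
  set F := localFactor e δ a q A B z w s
  obtain ⟨l, hl⟩ : ∃ l, Tendsto (fun x ↦ (x - x₀) * F 1 x) (𝓝[≠] x₀) (𝓝 l) := by
    have hg : ContinuousAt (fun x ↦ q * (∏ p, e (x + a p)) *
        (∏ l ∈ A, pairFactor e δ 1 (s l) x (z l)) * ∏ k ∈ B, crossFactor e δ 1 x (w k)) x₀ := by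
      refine (ContinuousAt.mul (by fun_prop) (tendsto_finsetProd A fun l hl ↦ ?_)).mul
        (tendsto_finsetProd B fun k hk ↦ ?_)
      · exact continuousAt_pairFactor he continuousAt_id continuousAt_const (hz l hl) _ _
      · exact continuousAt_crossFactor he continuousAt_id continuousAt_const (hw k hk) _
    refine ⟨_, (hc2.mul (hg.tendsto.mono_left nhdsWithin_le_nhds)).congr fun x ↦ ?_⟩
    simp only [F, localFactor, boundaryFactor, one_ne_zero, if_false, boundary, SignType.coe_one,
      one_mul]
    ring
  have h0 : Tendsto (fun x ↦ (x - x₀) * F 0 x) (𝓝[≠] x₀) (𝓝 0) := by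
    refine tendsto_sub_mul_of_continuousAt ?_
    rw [show F 0 = fun x ↦ ∏ l ∈ A, pairFactor e δ 0 (s l) x (z l) from
      funext fun x ↦ localFactor_zero_sign]
    exact tendsto_finsetProd A fun l hl ↦
      continuousAt_pairFactor he continuousAt_id continuousAt_const (hz l hl) _ _
  have hrefl : Tendsto (fun x ↦ 2 * x₀ - x) (𝓝[≠] x₀) (𝓝[≠] x₀) := by
    refine tendsto_nhdsWithin_iff.mpr ⟨?_, ?_⟩
    · have : ContinuousAt (fun x ↦ 2 * x₀ - x) x₀ := by fun_prop
      have := this.tendsto.mono_left (nhdsWithin_le_nhds (s := {x₀}ᶜ))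
      rwa [show 2 * x₀ - x₀ = x₀ by ring] at this
    · filter_upwards [self_mem_nhdsWithin] with x hx h
      apply hx
      have h : 2 * x₀ - x = x₀ := h
      show x = x₀
      linear_combination -h
  have hm : Tendsto (fun x ↦ (x - x₀) * F (-1) x) (𝓝[≠] x₀) (𝓝 (-l)) := by
    refine ((hl.comp hrefl).neg).congr fun x ↦ ?_
    have : F 1 (2 * x₀ - x) = F (-1) x := by
      simp only [F]
      rw [sub_eq_add_neg, add_comm, localFactor_add_lattice he hAB ha z w s 1 (-x) h2]
      rw [← localFactor_neg A B z w s (-1) x, neg_neg]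
    simp only [Function.comp_apply, this]
    ring
  have := (h0.add hm).add hl
  rw [zero_add, neg_add_cancel] at this
  refine this.congr fun x ↦ ?_
  rw [sum_signType]

end Sums

section Factors

variable {L : PeriodPair} {e : ℂ → ℂ} (he : IsSigmaLike L e) {δ : ℂ} {a : Fin 4 → ℂ} {q : ℂ}

include he in
lemma tendsto_sub_mul_crossFactor_left {v x₀ : ℂ} (hx₀ : x₀ = v - δ / 2) (hv : e (2 * v) ≠ 0)
    (hv' : e (2 * x₀) ≠ 0) (hδ : e δ ≠ 0) (s : SignType) :
    Tendsto (fun x ↦ (x - x₀) * crossFactor e δ s x v) (𝓝[≠] x₀)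
      (𝓝 (if s = 1 then (deriv e 0)⁻¹ * (pm e x₀ v / e (2 * v)) else 0)) := by
  have hc := he.differentiable.continuous
  split_ifs with hs
  · subst hs
    have h := tendsto_sub_mul_of_eq_div_mul he (y := x₀) (f := fun x ↦ crossFactor e δ 1 x v)
      (g := fun x ↦ pm e x v / e (x + δ / 2 + v)) ?_ ?_
    · rwa [show x₀ + δ / 2 + v = 2 * v by rw [hx₀]; ring] at h
    · refine (continuousAt_pm he (by fun_prop) (by fun_prop)).div (by fun_prop) ?_
      rwa [show x₀ + δ / 2 + v = 2 * v by rw [hx₀]; ring]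
    · intro x
      rw [crossFactor, if_neg one_ne_zero, SignType.coe_one, one_mul, shiftRatio, inv_div,
        pm.eq_1 e (x + δ / 2) v, show x + δ / 2 - v = x - x₀ by rw [hx₀]; ring]
      ring
  · refine tendsto_sub_mul_of_continuousAt
      (continuousAt_crossFactor_sign he continuousAt_id continuousAt_const fun h0 ↦ ?_)
    have hs' : s = -1 := by revert s; decide
    show pm e (s * x₀ + δ / 2) v ≠ 0
    rw [hs', SignType.coe_neg_one, pm, show -1 * x₀ + δ / 2 + v = δ by rw [hx₀]; ring,
      show -1 * x₀ + δ / 2 - v = -(2 * x₀) by rw [hx₀]; ring, he.neg]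
    exact mul_ne_zero hδ (neg_ne_zero.mpr hv')

include he in
lemma tendsto_sub_mul_crossFactor_right {v x₀ : ℂ} (hx₀ : x₀ = v - δ / 2) (hv : e (2 * v) ≠ 0)
    (hv' : e (2 * x₀) ≠ 0) (hδ : e δ ≠ 0) (s : SignType) :
    Tendsto (fun x ↦ (x - x₀) * crossFactor e δ s v x) (𝓝[≠] x₀)
      (𝓝 (if s = -1 then (deriv e 0)⁻¹ * (pm e x₀ v / e (2 * x₀)) else 0)) := by
  have hc := he.differentiable.continuous
  split_ifs with hs
  · subst hs
    have h := tendsto_sub_mul_of_eq_div_mul he (y := x₀) (f := fun x ↦ crossFactor e δ (-1) v x)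
      (g := fun x ↦ pm e x v / e (x + x₀)) ?_ ?_
    · rwa [← two_mul] at h
    · refine (continuousAt_pm he (by fun_prop) (by fun_prop)).div (by fun_prop) ?_
      rwa [← two_mul]
    · intro x
      rw [crossFactor, if_neg (by decide), SignType.coe_neg_one, neg_one_mul, shiftRatio, inv_div,
        pm_neg_left he, show -v + δ / 2 = -x₀ by rw [hx₀]; ring, pm_neg_left he, pm_comm he v,
        pm_comm he x₀, neg_div_neg_eq, pm.eq_1 e x x₀]
      ring
  · refine tendsto_sub_mul_of_continuousAt
      (continuousAt_crossFactor_sign he continuousAt_const continuousAt_id fun h0 ↦ ?_)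
    have hs' : s = 1 := by revert s; decide
    show pm e (s * v + δ / 2) x₀ ≠ 0
    rw [hs', SignType.coe_one, pm, show 1 * v + δ / 2 + x₀ = 2 * v by rw [hx₀]; ring,
      show 1 * v + δ / 2 - x₀ = δ by rw [hx₀]; ring]
    exact mul_ne_zero hv hδ

include he in
lemma crossFactor_self {s : SignType} (hs : s ≠ 0) (v : ℂ) : crossFactor e δ s v v = 0 := by
  rw [crossFactor, if_neg hs, shiftRatio, sign_mul_pm_left he s hs, pm_self he]
  simp

include he in
lemma pairFactor_mul_crossFactor_of_zero (t : SignType) {y v : ℂ} (h : pm e y v ≠ 0)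
    (h' : CrossRegular e δ y v) :
    pairFactor e δ 0 t v y * crossFactor e δ t y v = 1 := by
  rw [pairFactor, if_pos rfl, crossFactor]
  split_ifs with ht
  · simp
  · refine mul_inv_cancel₀ (div_ne_zero (h'.pm_sign he ht) ?_)
    rwa [sign_mul_pm_left he t ht]

end Factors

section Sums

variable {L : PeriodPair} {e : ℂ → ℂ} (he : IsSigmaLike L e) {δ : ℂ} {a b : Fin 4 → ℂ} {q : ℂ}
variable {ι : Type*} [LinearOrder ι] [Fintype ι]

include he in
/-- If two variables of different kinds coincide, they drop out of the sum. -/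
lemma configSum_insert_insert_of_eq {A B : Finset ι} {i k : ι} (hi : i ∉ A) (hk : k ∉ B)
    {z w : ι → ℂ} (hik : z i = w k) (h : ∀ l ∈ A, pm e (z l) (w k) ≠ 0)
    (h' : ∀ l ∈ A, CrossRegular e δ (z l) (w k)) :
    configSum e δ a q (insert i A) (insert k B) z w = configSum e δ a q A B z w := by
  rw [configSum_insert hi, configSum]
  refine sum_congr rfl fun s _ ↦ ?_
  rw [sum_eq_single 0]
  · rw [localFactor_zero_sign, configTerm_insert_right A hk, mul_left_comm, ← prod_mul_distrib, hik,
      prod_eq_one fun l hl ↦ pairFactor_mul_crossFactor_of_zero he (s l) (h l hl) (h' l hl),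
      mul_one]
  · intro ε _ hε
    rw [localFactor_insert_right A hk, hik, crossFactor_self he hε, mul_zero, zero_mul]
  · simp

include he in
lemma tendsto_leftFun_of_cross {A B : Finset ι} {k : ι} (hk : k ∉ B) {z w : ι → ℂ} {x₀ : ℂ}
    (hx₀ : x₀ = w k - δ / 2) (h2 : e (2 * w k) ≠ 0) (h2' : e (2 * x₀) ≠ 0) (hδ : e δ ≠ 0)
    (hz : ∀ l ∈ A, CrossRegular e δ (z l) (w k)) (hw : ∀ m ∈ B, CrossRegular e δ x₀ (w m)) :
    Tendsto (fun x ↦ (x - x₀) * leftFun e δ a q A (insert k B) z w x) (𝓝[≠] x₀)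
      (𝓝 ((deriv e 0)⁻¹ * (pm e x₀ (w k) / e (2 * w k)) * (q * boundary e a x₀) *
        (∏ l ∈ A, shiftRatio e δ x₀ (z l)) * (∏ m ∈ B, (shiftRatio e δ x₀ (w m))⁻¹) *
        configSum e δ a q A B z w)) := by
  have hz' : ∀ l ∈ A, pm e x₀ (z l) ≠ 0 := fun l hl ↦ hx₀ ▸ ((hz l hl).symm he).2
  have hz'' : ∀ l ∈ A, pm e (((1 : SignType) : ℂ) * x₀ + δ) (z l) ≠ 0 := fun l hl ↦ by
    have := ((hz l hl).symm he).1
    rwa [SignType.coe_one, one_mul, show x₀ + δ = w k + δ / 2 by rw [hx₀]; ring]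
  set c : SignType → ℂ :=
    fun s ↦ if s = 1 then (deriv e 0)⁻¹ * (pm e x₀ (w k) / e (2 * w k)) else 0 with hc
  have hexp : ∀ x, (x - x₀) * leftFun e δ a q A (insert k B) z w x =
      ∑ s ∈ configs A, ∑ ε : SignType, localFactor e δ a q A B z w s ε x *
        ((x - x₀) * crossFactor e δ ε x (w k)) * configTerm e δ a q A (insert k B) z w s := by
    intro x
    simp only [leftFun, mul_sum, localFactor_insert_right A hk]
    exact sum_congr rfl fun s _ ↦ sum_congr rfl fun ε _ ↦ by ring
  have hlim : (deriv e 0)⁻¹ * (pm e x₀ (w k) / e (2 * w k)) * (q * boundary e a x₀) *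
        (∏ l ∈ A, shiftRatio e δ x₀ (z l)) * (∏ m ∈ B, (shiftRatio e δ x₀ (w m))⁻¹) *
        configSum e δ a q A B z w =
      ∑ s ∈ configs A, ∑ ε : SignType, localFactor e δ a q A B z w s ε x₀ * c ε *
        configTerm e δ a q A (insert k B) z w s := by
    rw [configSum, mul_sum]
    refine sum_congr rfl fun s _ ↦ ?_
    rw [sum_eq_single 1 (by intro ε _ hε; simp [hc, hε]) (by simp), configTerm_insert_right A hk]
    have hf : ∏ l ∈ A, shiftRatio e δ x₀ (z l) = (∏ l ∈ A, pairFactor e δ 1 (s l) x₀ (z l)) *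
        ∏ l ∈ A, crossFactor e δ (s l) (z l) (w k) := by
      rw [← prod_mul_distrib]
      refine prod_congr rfl fun l hl ↦ ?_
      rw [pairFactor_mul_crossFactor he one_ne_zero (s l) (.inl _) (hz'' l hl), SignType.coe_one,
        one_mul]
      rw [SignType.coe_one, one_mul, hx₀, sub_add_cancel]
    have hcr : ∏ m ∈ B, (shiftRatio e δ x₀ (w m))⁻¹ = ∏ m ∈ B, crossFactor e δ 1 x₀ (w m) := by
      simp [crossFactor]
    rw [hf, hcr, localFactor, boundaryFactor, if_neg one_ne_zero, SignType.coe_one, one_mul, hc]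
    simp only [if_true]
    ring
  rw [hlim, funext hexp]
  refine tendsto_finsetSum _ fun s _ ↦ tendsto_finsetSum _ fun ε _ ↦ Tendsto.mul_const _ ?_
  exact ((continuousAt_localFactor he h2' hz' hw s ε).tendsto.mono_left nhdsWithin_le_nhds).mul
    (tendsto_sub_mul_crossFactor_left he hx₀ h2 h2' hδ ε)

include he in
lemma tendsto_rightFun_of_cross {A B : Finset ι} {k : ι} (hk : k ∉ B) {z w : ι → ℂ} {x₀ : ℂ}
    (hx₀ : x₀ = w k - δ / 2) (h2 : e (2 * w k) ≠ 0) (h2' : e (2 * x₀) ≠ 0) (hδ : e δ ≠ 0)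
    (hw : ∀ m ∈ B, CrossRegular e δ x₀ (w m)) :
    Tendsto (fun x ↦ (x - x₀) * rightFun e δ a q A (insert k B) z w x) (𝓝[≠] x₀)
      (𝓝 ((deriv e 0)⁻¹ * (pm e x₀ (w k) / e (2 * x₀)) * (q * boundary e a (-w k)) *
        (∏ l ∈ A, shiftRatio e δ x₀ (z l)) * (∏ m ∈ B, (shiftRatio e δ x₀ (w m))⁻¹) *
        configSum e δ a q B A w z)) := by
  have hw' : ∀ m ∈ B, pm e (((-1 : SignType) : ℂ) * w k + δ) (w m) ≠ 0 := fun m hm ↦ by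
    have := (hw m hm).2
    rw [← pm_neg_left he] at this
    rwa [SignType.coe_neg_one, show -1 * w k + δ = -(x₀ - δ / 2) by rw [hx₀]; ring]
  set c : SignType → ℂ :=
    fun s ↦ if s = -1 then (deriv e 0)⁻¹ * (pm e x₀ (w k) / e (2 * x₀)) else 0 with hc
  have hexp : ∀ x, (x - x₀) * rightFun e δ a q A (insert k B) z w x =
      ∑ s ∈ configs B, ∑ ε : SignType, localFactor e δ a q B A w z s ε (w k) *
        configTerm e δ a q B A w z s * ((x - x₀) * crossFactor e δ ε (w k) x) *
        ∏ m ∈ B, crossFactor e δ (s m) (w m) x := by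
    intro x
    rw [rightFun, sum_configs_insert hk, mul_sum]
    refine sum_congr rfl fun s _ ↦ ?_
    rw [mul_sum]
    refine sum_congr rfl fun ε _ ↦ ?_
    rw [configTerm_insert_update hk, prod_insert hk, Function.update_self,
      prod_congr rfl fun m hm ↦ by rw [Function.update_of_ne (ne_of_mem_of_not_mem hm hk)]]
    ring
  have hlim : (deriv e 0)⁻¹ * (pm e x₀ (w k) / e (2 * x₀)) * (q * boundary e a (-w k)) *
        (∏ l ∈ A, shiftRatio e δ x₀ (z l)) * (∏ m ∈ B, (shiftRatio e δ x₀ (w m))⁻¹) *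
        configSum e δ a q B A w z =
      ∑ s ∈ configs B, ∑ ε : SignType, localFactor e δ a q B A w z s ε (w k) *
        configTerm e δ a q B A w z s * c ε * ∏ m ∈ B, crossFactor e δ (s m) (w m) x₀ := by
    rw [configSum, mul_sum]
    refine sum_congr rfl fun s _ ↦ ?_
    rw [sum_eq_single (-1) (by intro ε _ hε; simp [hc, hε]) (by simp)]
    have hf : ∏ m ∈ B, (shiftRatio e δ x₀ (w m))⁻¹ =
        (∏ m ∈ B, pairFactor e δ (-1) (s m) (w k) (w m)) *
        ∏ m ∈ B, crossFactor e δ (s m) (w m) x₀ := by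
      rw [← prod_mul_distrib]
      refine prod_congr rfl fun m hm ↦ ?_
      rw [pairFactor_mul_crossFactor he (by decide) (s m) (.inr _) (hw' m hm),
        SignType.coe_neg_one, inv_shiftRatio he, neg_one_mul]
      · rw [hx₀]
        ring_nf
      · rw [SignType.coe_neg_one, hx₀]
        ring
    have hcr : ∏ l ∈ A, shiftRatio e δ x₀ (z l) = ∏ l ∈ A, crossFactor e δ (-1) (w k) (z l) := by
      refine prod_congr rfl fun l _ ↦ ?_
      rw [crossFactor, if_neg (by decide), inv_shiftRatio he, SignType.coe_neg_one, hx₀]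
      ring_nf
    rw [hf, hcr, localFactor, boundaryFactor, if_neg (by decide), SignType.coe_neg_one,
      neg_one_mul, hc]
    simp only [if_true]
    ring
  rw [hlim, funext hexp]
  refine tendsto_finsetSum _ fun s _ ↦ tendsto_finsetSum _ fun ε _ ↦
    (Tendsto.const_mul _ (tendsto_sub_mul_crossFactor_right he hx₀ h2 h2' hδ ε)).mul
    (tendsto_finsetProd B fun m hm ↦ ?_)
  exact (continuousAt_crossFactor he continuousAt_const continuousAt_id ((hw m hm).symm he)
    (s m)).tendsto.mono_left nhdsWithin_le_nhds

include he in
lemma boundary_neg_of_reflection {v x₀ : ℂ} (hx₀ : x₀ = v - δ / 2) (hb : ∀ p, b p = δ / 2 - a p) :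
    boundary e b (-v) = -((∏ p, e (x₀ + a p)) / e (2 * v)) := by
  have h : ∀ p, e (-v + b p) = -e (x₀ + a p) := fun p ↦ by
    rw [← he.neg, hb, hx₀]
    ring_nf
  rw [boundary, mul_neg, he.neg]
  simp only [h, Fin.prod_univ_four]
  ring

include he in
/-- The residues of the two sides at a coincidence of shifted variables of different kinds are
proportional to the sums with these variables removed. -/
lemma tendsto_leftFun_sub_rightFun_of_cross {A B : Finset ι} {k : ι} (hk : k ∉ B) {z w : ι → ℂ}
    {x₀ : ℂ} (hx₀ : x₀ = w k - δ / 2) (h2 : e (2 * w k) ≠ 0) (h2' : e (2 * x₀) ≠ 0)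
    (hδ : e δ ≠ 0) (hz : ∀ l ∈ A, CrossRegular e δ (z l) (w k))
    (hw : ∀ m ∈ B, CrossRegular e δ x₀ (w m)) (hb : ∀ p, b p = δ / 2 - a p)
    (h : configSum e δ a q A B z w = configSum e δ b (-q) B A w z) :
    Tendsto (fun x ↦ (x - x₀) * (leftFun e δ a q A (insert k B) z w x -
      rightFun e δ b (-q) A (insert k B) z w x)) (𝓝[≠] x₀) (𝓝 0) := by
  simp only [mul_sub]
  have h1 := (tendsto_leftFun_of_cross he hk hx₀ h2 h2' hδ hz hw (a := a) (q := q)).sub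
    (tendsto_rightFun_of_cross he hk hx₀ h2 h2' hδ hw (a := b) (q := -q) (A := A) (z := z))
  convert! h1 using 2
  rw [h, boundary_neg_of_reflection he hx₀ hb, boundary]
  ring

end Sums

/-- For an even periodic function, the condition for a singularity to be removable is preserved
by periods and reflections. -/
lemma tendsto_sub_mul_of_even_of_periodic {L : PeriodPair} {f : ℂ → ℂ} (heven : ∀ x, f (-x) = f x)
    (hper : ∀ x, ∀ ω ∈ L.lattice, f (x + ω) = f x) {x₀ x₁ : ℂ}
    (h : x₀ - x₁ ∈ L.lattice ∨ x₀ + x₁ ∈ L.lattice)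
    (hlim : Tendsto (fun x ↦ (x - x₁) * f x) (𝓝[≠] x₁) (𝓝 0)) :
    Tendsto (fun x ↦ (x - x₀) * f x) (𝓝[≠] x₀) (𝓝 0) := by
  have key : ∀ φ : ℂ → ℂ, Continuous φ → (∀ x, φ x = x₁ → x = x₀) → φ x₀ = x₁ →
      Tendsto (fun x ↦ (φ x - x₁) * f (φ x)) (𝓝[≠] x₀) (𝓝 0) := by
    intro φ hφ hinj h0
    refine hlim.comp (tendsto_nhdsWithin_iff.mpr ⟨?_, ?_⟩)
    · exact (h0 ▸ hφ.tendsto x₀).mono_left nhdsWithin_le_nhds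
    · filter_upwards [self_mem_nhdsWithin] with x hx h1 using hx (hinj x h1)
  rcases h with h | h
  · refine (key (fun x ↦ x + -(x₀ - x₁)) (by fun_prop)
      (fun x hx ↦ by linear_combination hx) (by ring)).congr fun x ↦ ?_
    rw [hper x _ (neg_mem h)]
    ring
  · have := (key (fun x ↦ -x + (x₀ + x₁)) (by fun_prop)
      (fun x hx ↦ by linear_combination -hx) (by ring)).neg
    rw [neg_zero] at this
    refine this.congr fun x ↦ ?_
    rw [hper (-x) _ h, heven]
    ring

section Sums

variable {L : PeriodPair} {e : ℂ → ℂ} (he : IsSigmaLike L e) {δ : ℂ} {a b : Fin 4 → ℂ} {q : ℂ}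
variable {ι : Type*} [LinearOrder ι]

variable (e δ) in
/-- The denominators on both sides of the duality do not vanish. -/
structure Regular (A B : Finset ι) (z w : ι → ℂ) : Prop where
  two_left : ∀ i ∈ A, e (2 * z i) ≠ 0
  two_right : ∀ k ∈ B, e (2 * w k) ≠ 0
  left : ∀ i ∈ A, ∀ j ∈ A, i ≠ j → pm e (z i) (z j) ≠ 0
  right : ∀ k ∈ B, ∀ l ∈ B, k ≠ l → pm e (w k) (w l) ≠ 0
  cross : ∀ i ∈ A, ∀ k ∈ B, CrossRegular e δ (z i) (w k)

variable (e δ) in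
/-- Conditions under which all the poles of the two sides are simple and under which two variables
of different kinds may be identified. -/
structure Generic (A B : Finset ι) (z w : ι → ℂ) : Prop extends Regular e δ A B z w where
  cross_ne : ∀ i ∈ A, ∀ k ∈ B, pm e (z i) (w k) ≠ 0
  half_shift : ∀ k ∈ B, ∀ l ∈ B, CrossRegular e δ (w k) (w l)
  shift : ∀ k ∈ B, ∀ l ∈ B, pm e (w k + δ) (w l) ≠ 0 ∧ pm e (w k - δ) (w l) ≠ 0

lemma Generic.mono {A A' B B' : Finset ι} {z w : ι → ℂ} (h : Generic e δ A B z w) (hA : A' ⊆ A)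
    (hB : B' ⊆ B) : Generic e δ A' B' z w where
  two_left i hi := h.two_left i (hA hi)
  two_right k hk := h.two_right k (hB hk)
  left i hi j hj := h.left i (hA hi) j (hA hj)
  right k hk l hl := h.right k (hB hk) l (hB hl)
  cross i hi k hk := h.cross i (hA hi) k (hB hk)
  cross_ne i hi k hk := h.cross_ne i (hA hi) k (hB hk)
  half_shift k hk l hl := h.half_shift k (hB hk) l (hB hl)
  shift k hk l hl := h.shift k (hB hk) l (hB hl)

variable [Fintype ι]

lemma leftFun_eq_configSum {A : Finset ι} {i : ι} (hi : i ∉ A) (B : Finset ι) (z w : ι → ℂ)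
    (x : ℂ) : leftFun e δ a q A B z w x =
      configSum e δ a q (insert i A) B (Function.update z i x) w := by
  have hz : ∀ j ∈ A, z j = Function.update z i x j := fun j hj ↦
    (Function.update_of_ne (ne_of_mem_of_not_mem hj hi) _ _).symm
  rw [configSum_eq_leftFun hi, Function.update_self]
  refine sum_congr rfl fun s _ ↦ sum_congr rfl fun ε _ ↦ ?_
  rw [localFactor_congr hz (fun _ _ ↦ rfl) fun _ _ ↦ rfl,
    configTerm_congr hz (fun _ _ ↦ rfl) fun _ _ ↦ rfl]

lemma rightFun_eq_configSum {A : Finset ι} {i : ι} (hi : i ∉ A) (B : Finset ι) (z w : ι → ℂ)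
    (x : ℂ) : rightFun e δ a q A B z w x =
      configSum e δ a q B (insert i A) w (Function.update z i x) := by
  have hz : ∀ j ∈ A, z j = Function.update z i x j := fun j hj ↦
    (Function.update_of_ne (ne_of_mem_of_not_mem hj hi) _ _).symm
  rw [configSum_eq_rightFun hi, Function.update_self]
  refine sum_congr rfl fun s _ ↦ ?_
  rw [configTerm_congr (fun _ _ ↦ rfl) hz fun _ _ ↦ rfl]

include he in
lemma tendsto_at_cross_pole {A B : Finset ι} {i k : ι} (hi : i ∉ A) (hk : k ∈ B) {z w : ι → ℂ}
    (hg : Generic e δ A B z w) (hδ : e δ ≠ 0) (hb : ∀ p, b p = δ / 2 - a p)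
    (h : configSum e δ a q A (B.erase k) z w = configSum e δ b (-q) (B.erase k) A w z)
    {v x₀ : ℂ} (hv : v = w k ∨ v = -w k) (hx₀ : x₀ = v - δ / 2) :
    Tendsto (fun x ↦ (x - x₀) * (leftFun e δ a q A B z w x -
      rightFun e δ b (-q) A B z w x)) (𝓝[≠] x₀) (𝓝 0) := by
  set w' := Function.update w k v with hw'
  have hw'k : w' k = v := Function.update_self ..
  have hw'm : ∀ m ∈ B.erase k, w' m = w m := fun m hm ↦
    Function.update_of_ne (ne_of_mem_erase hm) _ _
  have hleft : leftFun e δ a q A B z w = leftFun e δ a q A B z w' := by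
    ext x
    rw [leftFun_eq_configSum hi, leftFun_eq_configSum hi]
    rcases hv with rfl | rfl
    · rw [hw', Function.update_eq_self]
    · rw [hw', configSum_update_neg_right]
  have hright : rightFun e δ b (-q) A B z w = rightFun e δ b (-q) A B z w' := by
    ext x
    rw [rightFun_eq_configSum hi, rightFun_eq_configSum hi]
    rcases hv with rfl | rfl
    · rw [hw', Function.update_eq_self]
    · rw [hw', configSum_update_neg hk]
  have hpm : ∀ {c x}, pm e (w k + c) x ≠ 0 ∧ pm e (w k - c) x ≠ 0 →
      pm e (v + c) x ≠ 0 ∧ pm e (v - c) x ≠ 0 := by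
    intro c x hcx
    rcases hv with rfl | rfl
    · exact hcx
    · rw [show -w k + c = -(w k - c) by ring, show -w k - c = -(w k + c) by ring,
        pm_neg_left he, pm_neg_left he]
      exact hcx.symm
  have h2 : e (2 * v) ≠ 0 := by
    rcases hv with rfl | rfl
    · exact hg.two_right k hk
    · rw [mul_neg, he.neg]
      exact neg_ne_zero.mpr (hg.two_right k hk)
  have h2' : e (2 * x₀) ≠ 0 := by
    have h3 := (hpm (hg.shift k hk k hk)).2
    have h4 : pm e (v - δ) v ≠ 0 := by
      rcases hv with rfl | rfl
      · exact h3
      · rwa [pm_neg_right]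
    rw [hx₀]
    convert! left_ne_zero_of_mul h4 using 2
    ring
  rw [hleft, hright, ← insert_erase hk]
  refine tendsto_leftFun_sub_rightFun_of_cross he (notMem_erase k B) (hw'k.symm ▸ hx₀)
    (hw'k.symm ▸ h2) h2' hδ ?_ ?_ hb ?_
  · intro l hl
    rw [hw'k]
    exact CrossRegular.symm he (hpm ((hg.cross l hl k hk).symm he))
  · intro m hm
    rw [hw'm m hm, hx₀, CrossRegular, sub_add_cancel, show v - δ / 2 - δ / 2 = v - δ by ring]
    refine ⟨?_, (hpm (hg.shift k hk m (mem_of_mem_erase hm))).2⟩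
    have := hg.right k hk m (mem_of_mem_erase hm) (ne_of_mem_erase hm).symm
    rcases hv with rfl | rfl
    · exact this
    · rwa [pm_neg_left he]
  · rwa [configSum_congr (fun _ _ ↦ rfl) hw'm, configSum_congr hw'm fun _ _ ↦ rfl]

include he in
/-- The duality at generic points. -/
theorem configSum_duality_of_generic (hδ : e δ ≠ 0) (ha : ∑ p, a p = δ)
    (hb : ∀ p, b p = δ / 2 - a p) (A : Finset ι) : ∀ {B : Finset ι}, #B = #A → ∀ {z w : ι → ℂ},
    Generic e δ A B z w → configSum e δ a q A B z w = configSum e δ b (-q) B A w z := by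
  induction A using Finset.induction_on with
  | empty =>
    intro B hB z w _
    rw [card_empty, card_eq_zero] at hB
    simp [hB, configSum, configs_empty, configTerm]
  | insert i A hi ih =>
    intro B hB z w hgen
    have hAB : #B = #A + 1 := by rw [hB, card_insert_of_notMem hi]
    obtain ⟨k₀, hk₀⟩ : B.Nonempty := card_pos.mp (by omega)
    have hg : Generic e δ A B z w := hgen.mono (subset_insert i A) subset_rfl
    have ih' : ∀ k ∈ B, configSum e δ a q A (B.erase k) z w =
        configSum e δ b (-q) (B.erase k) A w z := fun k hk ↦
      ih (by rw [card_erase_of_mem hk, hAB, add_tsub_cancel_right])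
        (hg.mono subset_rfl (erase_subset k B))
    set f : ℂ → ℂ := fun x ↦ leftFun e δ a q A B z w x - rightFun e δ b (-q) A B z w x with hf
    have heven : ∀ x, f (-x) = f x := fun x ↦ by simp only [hf, leftFun_neg, rightFun_neg]
    have hper : ∀ x, ∀ ω ∈ L.lattice, f (x + ω) = f x := fun x ω hω ↦ by
      simp only [hf, leftFun_add_lattice he hAB ha z w x hω, rightFun_add_lattice he A B z w x hω]
    have hcont : ∀ {x₀}, e (2 * x₀) ≠ 0 → (∀ l ∈ A, pm e x₀ (z l) ≠ 0) →
        (∀ k ∈ B, CrossRegular e δ x₀ (w k)) → ContinuousAt f x₀ := fun h2 hz hw ↦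
      (continuousAt_leftFun he h2 hz hw).sub (continuousAt_rightFun he hw)
    have hlim : ∀ x₀, Tendsto (fun x ↦ (x - x₀) * f x) (𝓝[≠] x₀) (𝓝 0) := by
      intro x₀
      by_cases hw : ∀ k ∈ B, CrossRegular e δ x₀ (w k)
      swap
      · push Not at hw
        obtain ⟨k, hk, hw⟩ := hw
        have hp := fun v hv ↦ tendsto_at_cross_pole he hi hk hg hδ hb (ih' k hk) (v := v) hv rfl
        have h4 : (x₀ + δ / 2 + w k ∈ L.lattice ∨ x₀ + δ / 2 - w k ∈ L.lattice) ∨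
            (x₀ - δ / 2 + w k ∈ L.lattice ∨ x₀ - δ / 2 - w k ∈ L.lattice) := by
          simp only [← he.eq_zero_iff, ← mul_eq_zero]
          by_contra! h
          exact hw (mul_ne_zero_iff.mp h)
        rcases h4 with (h | h) | (h | h)
        · refine tendsto_sub_mul_of_even_of_periodic heven hper (.inl ?_) (hp (-w k) (.inr rfl))
          convert! h using 1; ring
        · refine tendsto_sub_mul_of_even_of_periodic heven hper (.inl ?_) (hp (w k) (.inl rfl))
          convert! h using 1; ring
        · refine tendsto_sub_mul_of_even_of_periodic heven hper (.inr ?_) (hp (w k) (.inl rfl))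
          convert! h using 1; ring
        · refine tendsto_sub_mul_of_even_of_periodic heven hper (.inr ?_) (hp (-w k) (.inr rfl))
          convert! h using 1; ring
      have hR : Tendsto (fun x ↦ (x - x₀) * rightFun e δ b (-q) A B z w x) (𝓝[≠] x₀) (𝓝 0) :=
        tendsto_sub_mul_of_continuousAt (continuousAt_rightFun he hw)
      by_cases hz : ∀ l ∈ A, pm e x₀ (z l) ≠ 0
      swap
      · push Not at hz
        obtain ⟨j, hj, hz⟩ := hz
        have h1 : x₀ - z j ∈ L.lattice ∨ x₀ + z j ∈ L.lattice := by
          rw [← he.eq_zero_iff, ← he.eq_zero_iff, or_comm]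
          exact mul_eq_zero.mp hz
        refine tendsto_sub_mul_of_even_of_periodic heven hper h1 ?_
        have hwj := hg.cross j hj
        have h3 := tendsto_leftFun_of_mem he (notMem_erase j A) (B := B) (w := w) (a := a) (q := q)
          (hg.two_left j hj) (fun l hl ↦ hg.left j hj l (mem_of_mem_erase hl)
          (ne_of_mem_erase hl).symm) hwj
        rw [insert_erase hj] at h3
        have h4 := h3.sub (tendsto_sub_mul_of_continuousAt
          (continuousAt_rightFun he hwj (a := b) (q := -q) (A := A) (z := z)))
        simpa only [sub_zero, ← mul_sub] using h4
      by_cases h2 : e (2 * x₀) = 0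
      · have h3 := (tendsto_leftFun_of_two_mul_mem he hAB ha (q := q)
          ((he.eq_zero_iff _).mp h2) hz hw).sub hR
        simpa only [sub_zero, ← mul_sub] using h3
      · exact tendsto_sub_mul_of_continuousAt (hcont h2 hz hw)
    have hmer : ∀ x, MeromorphicAt f x := fun x ↦
      (meromorphicAt_leftFun he A B z w x).sub (meromorphicAt_rightFun he A B z w x)
    have hci : ContinuousAt f (z i) := by
      refine hcont (hgen.two_left i (mem_insert_self i A)) (fun l hl ↦ ?_) fun k hk ↦ ?_
      · exact hgen.left i (mem_insert_self i A) l (mem_insert_of_mem hl)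
          (ne_of_mem_of_not_mem hl hi).symm
      · exact hgen.cross i (mem_insert_self i A) k hk
    have hck : ContinuousAt f (w k₀) := by
      refine hcont (hg.two_right k₀ hk₀) (fun l hl ↦ ?_) fun k hk ↦ hg.half_shift k₀ hk₀ k hk
      rw [pm_comm he]
      exact neg_ne_zero.mpr (hg.cross_ne l hl k₀ hk₀)
    have hfk : f (w k₀) = 0 := by
      have hz : ∀ j ∈ A, Function.update z i (w k₀) j = z j := fun j hj ↦
        Function.update_of_ne (ne_of_mem_of_not_mem hj hi) _ _
      simp only [hf]
      rw [leftFun_eq_configSum hi, rightFun_eq_configSum hi, ← insert_erase hk₀,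
        configSum_insert_insert_of_eq he hi (notMem_erase k₀ B) (Function.update_self ..),
        configSum_insert_insert_of_eq he (notMem_erase k₀ B) hi (by rw [Function.update_self]),
        configSum_congr hz fun _ _ ↦ rfl, configSum_congr (fun _ _ ↦ rfl) hz, ih' k₀ hk₀, sub_self]
      · intro l hl
        rw [Function.update_self]
        exact hg.right l (mem_of_mem_erase hl) k₀ hk₀ (ne_of_mem_erase hl)
      · intro l hl
        rw [Function.update_self]
        exact hg.half_shift l (mem_of_mem_erase hl) k₀ hk₀
      · intro l hl
        rw [hz l hl]
        exact hg.cross_ne l hl k₀ hk₀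
      · intro l hl
        rw [hz l hl]
        exact hg.cross l hl k₀ hk₀
    have h := eq_of_periodic_of_removable hmer hlim hper hci hck
    rw [hfk] at h
    rw [configSum_eq_leftFun hi, configSum_eq_rightFun hi]
    exact sub_eq_zero.mp h

end Sums

section Density

variable {L : PeriodPair} {e : ℂ → ℂ} (he : IsSigmaLike L e) {δ : ℂ} {a b : Fin 4 → ℂ} {q : ℂ}

include he in
lemma eventually_ne_zero (c : ℂ) {d : ℂ} (h : e c ≠ 0 ∨ d ≠ 0) :
    ∀ᶠ t in 𝓝[≠] (0 : ℂ), e (c + t * d) ≠ 0 := by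
  by_cases hd : d = 0
  · simp [hd, h.resolve_right (not_not.mpr hd)]
  have hc : ContinuousAt (fun t : ℂ ↦ c + t * d) 0 := by fun_prop
  have hmem := hc.tendsto (L.compl_lattice_sdiff_singleton_mem_nhds (c + 0 * d))
  filter_upwards [nhdsWithin_le_nhds hmem, self_mem_nhdsWithin] with t ht ht0
  rw [he.ne_zero_iff]
  intro hL
  refine ht ⟨hL, fun h ↦ ht0 ?_⟩
  have h : c + t * d = c + 0 * d := h
  simpa [hd] using h

include he in
lemma eventually_pm_ne_zero {N : ℕ} (w : Fin N → ℂ) (k l : Fin N) {c : ℂ} (hc : e c ≠ 0) :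
    ∀ᶠ t in 𝓝[≠] (0 : ℂ),
      pm e (w k + t * ((k : ℕ) + 1) + c) (w l + t * ((l : ℕ) + 1)) ≠ 0 := by
  have h1 : (((k : ℕ) + 1 + ((l : ℕ) + 1) : ℕ) : ℂ) ≠ 0 := Nat.cast_ne_zero.mpr (by omega)
  have h2 : e (w k + c - w l) ≠ 0 ∨ ((k : ℕ) : ℂ) - ((l : ℕ) : ℂ) ≠ 0 := by
    by_cases hkl : k = l
    · subst hkl
      left
      rwa [add_sub_cancel_left]
    · right
      rw [sub_ne_zero]
      exact fun h ↦ hkl (Fin.ext (Nat.cast_injective h))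
  filter_upwards [eventually_ne_zero he (w k + c + w l) (.inr h1),
    eventually_ne_zero he _ h2] with t ht1 ht2
  refine mul_ne_zero ?_ ?_
  · convert! ht1 using 2
    push_cast
    ring
  · convert! ht2 using 2
    ring

include he in
/-- The duality of the sums over all assignments of signs. -/
theorem configSum_duality (hδ : δ ∉ L.lattice) (ha : ∑ p, a p = δ)
    (hb : ∀ p, b p = δ / 2 - a p) {N : ℕ} {A B : Finset (Fin N)} (hAB : #B = #A)
    {z w : Fin N → ℂ} (h : Regular e δ A B z w) :
    configSum e δ a q A B z w = configSum e δ b (-q) B A w z := by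
  set W : ℂ → Fin N → ℂ := fun t k ↦ w k + t * ((k : ℕ) + 1) with hW
  have hW0 : W 0 = w := by simp [hW]
  have hWc : ∀ k, ContinuousAt (fun t ↦ W t k) 0 := fun k ↦ by
    simp only [hW]
    fun_prop
  have hec := he.differentiable.continuous
  have hδ1 : e δ ≠ 0 := (he.ne_zero_iff δ).mpr hδ
  have hδ2 : e (δ / 2) ≠ 0 := by
    rw [he.ne_zero_iff]
    intro h
    apply hδ
    simpa using add_mem h h
  have hneg : ∀ {c}, e c ≠ 0 → e (-c) ≠ 0 := fun hc ↦ by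
    rw [he.neg]
    exact neg_ne_zero.mpr hc
  have hopen : ∀ {g : ℂ → ℂ}, ContinuousAt g 0 → g 0 ≠ 0 → ∀ᶠ t in 𝓝[≠] (0 : ℂ), g t ≠ 0 :=
    fun hg h0 ↦ nhdsWithin_le_nhds (hg.eventually_ne h0)
  have h1 : ∀ᶠ t in 𝓝[≠] (0 : ℂ), ∀ k ∈ B, e (2 * W t k) ≠ 0 := by
    refine (Finset.eventually_all B).mpr fun k hk ↦ hopen ?_ ?_
    · have := hWc k
      fun_prop
    · rw [hW0]
      exact h.two_right k hk
  have h2 : ∀ᶠ t in 𝓝[≠] (0 : ℂ), ∀ k ∈ B, ∀ l ∈ B, k ≠ l → pm e (W t k) (W t l) ≠ 0 := by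
    refine (Finset.eventually_all B).mpr fun k hk ↦ (Finset.eventually_all B).mpr fun l hl ↦ ?_
    rw [eventually_imp_distrib_left]
    intro hkl
    refine hopen (continuousAt_pm he (hWc k) (hWc l)) ?_
    rw [hW0]
    exact h.right k hk l hl hkl
  have h3 : ∀ᶠ t in 𝓝[≠] (0 : ℂ), ∀ i ∈ A, ∀ k ∈ B, CrossRegular e δ (z i) (W t k) := by
    refine (Finset.eventually_all A).mpr fun i hi ↦ (Finset.eventually_all B).mpr fun k hk ↦ ?_
    refine (hopen (continuousAt_pm he continuousAt_const (hWc k)) ?_).and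
      (hopen (continuousAt_pm he continuousAt_const (hWc k)) ?_)
    · rw [hW0]
      exact (h.cross i hi k hk).1
    · rw [hW0]
      exact (h.cross i hi k hk).2
  have h4 : ∀ᶠ t in 𝓝[≠] (0 : ℂ), ∀ i ∈ A, ∀ k ∈ B, pm e (z i) (W t k) ≠ 0 := by
    refine (Finset.eventually_all A).mpr fun i hi ↦ (Finset.eventually_all B).mpr fun k hk ↦ ?_
    have hk0 : ((k : ℕ) : ℂ) + 1 ≠ 0 := Nat.cast_add_one_ne_zero _
    filter_upwards [eventually_ne_zero he (z i + w k) (.inr hk0),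
      eventually_ne_zero he (z i - w k) (.inr (neg_ne_zero.mpr hk0))] with t ht1 ht2
    refine mul_ne_zero ?_ ?_
    · convert! ht1 using 2
      simp only [hW]
      ring
    · convert! ht2 using 2
      simp only [hW]
      ring
  have h5 : ∀ {c}, e c ≠ 0 → ∀ᶠ t in 𝓝[≠] (0 : ℂ), ∀ k ∈ B, ∀ l ∈ B,
      pm e (W t k + c) (W t l) ≠ 0 := fun hc ↦
    (Finset.eventually_all B).mpr fun k _ ↦ (Finset.eventually_all B).mpr fun l _ ↦
      eventually_pm_ne_zero he w k l hc
  have hev : ∀ᶠ t in 𝓝[≠] (0 : ℂ), configSum e δ a q A B z (W t) =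
      configSum e δ b (-q) B A (W t) z := by
    filter_upwards [h1, h2, h3, h4, h5 hδ1, h5 (hneg hδ1), h5 hδ2, h5 (hneg hδ2)] with
      t h1 h2 h3 h4 h5 h6 h7 h8
    refine configSum_duality_of_generic he hδ1 ha hb A hAB ?_
    exact
      { two_left := h.two_left
        two_right := h1
        left := h.left
        right := h2
        cross := h3
        cross_ne := h4
        half_shift := fun k hk l hl ↦ ⟨h7 k hk l hl, by
          rw [sub_eq_add_neg]; exact h8 k hk l hl⟩
        shift := fun k hk l hl ↦ ⟨h5 k hk l hl, by
          rw [sub_eq_add_neg]; exact h6 k hk l hl⟩ }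
  have hl : ContinuousAt (fun t ↦ configSum e δ a q A B z (W t)) 0 :=
    continuousAt_configSum he (z := fun _ ↦ z) (fun _ _ ↦ continuousAt_const) (fun k _ ↦ hWc k)
      h.two_left h.left (by rw [hW0]; exact h.cross)
  have hr : ContinuousAt (fun t ↦ configSum e δ b (-q) B A (W t) z) 0 :=
    continuousAt_configSum he (w := fun _ ↦ z) (fun k _ ↦ hWc k) (fun _ _ ↦ continuousAt_const)
      (by rw [hW0]; exact h.two_right) (by rw [hW0]; exact h.right)
      (by rw [hW0]; exact fun k hk i hi ↦ (h.cross i hi k hk).symm he)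
  have := tendsto_nhds_unique_of_eventuallyEq (hl.tendsto.mono_left nhdsWithin_le_nhds)
    (hr.tendsto.mono_left nhdsWithin_le_nhds) hev
  simpa only [hW0] using this

end Density

section Subsets

variable {ι : Type*} [Fintype ι]

/-- The assignment of the sign `1` to the elements of `P` and of `-1` to the other elements
of `M`. -/
def signs [DecidableEq ι] (P M : Finset ι) (i : ι) : SignType :=
  if i ∈ P then 1 else if i ∈ M then -1 else 0

lemma sum_configs_univ [DecidableEq ι] (f : (ι → SignType) → ℂ) :
    ∑ s ∈ configs univ, f s =
      ∑ I ∈ (univ : Finset ι).powerset, ∑ P ∈ I.powerset, f (signs P (I \ P)) := by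
  rw [sum_sigma']
  refine sum_bij' (fun s _ ↦ ⟨univ.filter (s · ≠ 0), univ.filter (s · = 1)⟩)
    (fun p _ ↦ signs p.2 (p.1 \ p.2)) ?_ ?_ ?_ ?_ ?_
  · intro s _
    simp only [mem_sigma, mem_powerset, subset_univ, true_and]
    intro i
    simp only [mem_filter, mem_univ, true_and]
    intro h
    simp [h]
  · intro p _
    simp [mem_configs]
  · intro s _
    ext i
    simp only [signs, mem_filter, mem_univ, true_and, Finset.mem_sdiff]
    generalize s i = t
    revert t
    decide
  · rintro ⟨I, P⟩ h
    simp only [mem_sigma, mem_powerset, subset_univ, true_and] at h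
    have h1 : univ.filter (fun i ↦ signs P (I \ P) i ≠ 0) = I := by
      ext i
      simp only [signs, mem_filter, mem_univ, true_and, Finset.mem_sdiff]
      by_cases hP : i ∈ P
      · simp [hP, h hP]
      · by_cases hI : i ∈ I <;> simp [hP, hI]
    have h2 : univ.filter (fun i ↦ signs P (I \ P) i = 1) = P := by
      ext i
      simp only [signs, mem_filter, mem_univ, true_and, Finset.mem_sdiff]
      by_cases hP : i ∈ P
      · simp [hP]
      · by_cases hI : i ∈ I <;> simp [hP, hI]
    simp only [h1, h2]
  · intro s _
    congr 1
    ext i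
    simp only [signs, mem_filter, mem_univ, true_and, Finset.mem_sdiff]
    generalize s i = t
    revert t
    decide

omit [Fintype ι] in
lemma prod_lt_union [LinearOrder ι] {M : Type*} [CommMonoid M] {A B : Finset ι}
    (hAB : Disjoint A B) {f : ι → ι → M} (hf : ∀ i j, f i j = f j i) :
    ∏ i ∈ A ∪ B, ∏ j ∈ A ∪ B with i < j, f i j =
      (∏ i ∈ A, ∏ j ∈ A with i < j, f i j) * (∏ i ∈ B, ∏ j ∈ B with i < j, f i j) *
        ∏ i ∈ A, ∏ j ∈ B, f i j := by
  induction A using Finset.induction_on with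
  | empty => simp
  | insert i A hi ih =>
    rw [disjoint_insert_left] at hAB
    have hi' : i ∉ A ∪ B := by simp [hi, hAB.1]
    rw [insert_union, prod_lt_insert hi' hf, ih hAB.2, prod_lt_insert hi hf, prod_insert hi,
      prod_union hAB.2]
    ac_rfl

lemma prod_univ_eq_prod_mul_prod_mul_prod [DecidableEq ι] {P M : Finset ι} (hPM : Disjoint P M)
    {R : Type*} [CommMonoid R] (f : ι → R) :
    ∏ i, f i = (∏ i ∈ P, f i) * (∏ i ∈ M, f i) * ∏ i ∈ (P ∪ M)ᶜ, f i := by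
  rw [← prod_union hPM, prod_mul_prod_compl]

end Subsets

section Bridge

variable (L : PeriodPair) (c δ : ℂ) (a : Fin 4 → ℂ) (q : ℂ)

lemma boundaryFactor_one (x : ℂ) : boundaryFactor (br L c) a q 1 x = q * Bplus L c a x := by
  rw [boundaryFactor, if_neg one_ne_zero, SignType.coe_one, one_mul]
  rfl

lemma boundaryFactor_neg_one (x : ℂ) :
    boundaryFactor (br L c) a q (-1) x = q * Bminus L c a x := by
  have he := isSigmaLike_br L c
  have h : ∀ p, br L c (-x + a p) = -br L c (x - a p) := fun p ↦ by
    rw [← he.neg]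
    ring_nf
  rw [boundaryFactor, if_neg (by decide), boundary, Bminus, SignType.coe_neg_one, neg_one_mul,
    mul_neg, he.neg]
  simp only [h, Fin.prod_univ_four]
  ring

lemma shiftRatio_eq_brPM (x y : ℂ) :
    shiftRatio (br L c) δ x y = brPM L c (x + δ / 2) y / brPM L c x y := rfl

lemma shiftRatio_neg_eq_brPM (x y : ℂ) :
    shiftRatio (br L c) δ (-x) y = brPM L c (x - δ / 2) y / brPM L c x y := by
  have he := isSigmaLike_br L c
  rw [shiftRatio, pm_neg_left he, ← pm_neg_left he, neg_add, neg_neg, ← sub_eq_add_neg]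
  rfl

lemma pairFactor_neg_one_neg_one (x y : ℂ) :
    pairFactor (br L c) δ (-1) (-1) x y = br L c (x + y - δ) / br L c (x + y) := by
  have he := isSigmaLike_br L c
  rw [pairFactor, if_neg (by decide), if_neg (by decide), SignType.coe_neg_one,
    show -1 * x + -1 * y + δ = -(x + y - δ) by ring, show -1 * x + -1 * y = -(x + y) by ring,
    he.neg, he.neg, neg_div_neg_eq]

lemma configTerm_signs {N : ℕ} (z w : Fin N → ℂ) {P M : Finset (Fin N)} (hPM : Disjoint P M) :
    configTerm (br L c) δ a q univ univ z w (signs P M) =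
      q ^ #(P ∪ M) * term L c δ a z w P M := by
  have hP : ∀ i ∈ P, signs P M i = 1 := fun i hi ↦ if_pos hi
  have hM : ∀ i ∈ M, signs P M i = -1 := fun i hi ↦ by
    rw [signs, if_neg (disjoint_right.mp hPM hi), if_pos hi]
  have hC : ∀ i ∈ (P ∪ M)ᶜ, signs P M i = 0 := fun i hi ↦ by
    rw [mem_compl, mem_union, not_or] at hi
    rw [signs, if_neg hi.1, if_neg hi.2]
  have hlt : ∀ {A : Finset (Fin N)} {i j : Fin N}, j ∈ A.filter (i < ·) → j ∈ A := fun h ↦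
    (mem_filter.mp h).1
  have hb : ∏ i, boundaryFactor (br L c) a q (signs P M i) (z i) =
      q ^ #(P ∪ M) * ((∏ i ∈ P, Bplus L c a (z i)) * ∏ i ∈ M, Bminus L c a (z i)) := by
    rw [prod_univ_eq_prod_mul_prod_mul_prod hPM,
      prod_congr rfl fun i hi ↦ by rw [hP i hi, boundaryFactor_one],
      prod_congr (s₁ := M) rfl fun i hi ↦ by rw [hM i hi, boundaryFactor_neg_one],
      prod_eq_one (s := (P ∪ M)ᶜ) fun i hi ↦ by rw [hC i hi, boundaryFactor, if_pos rfl],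
      prod_mul_distrib, prod_mul_distrib, prod_const, prod_const, card_union_of_disjoint hPM]
    ring
  have hc : ∏ i, ∏ k, crossFactor (br L c) δ (signs P M i) (z i) (w k) =
      (∏ i ∈ P, ∏ k, brPM L c (z i) (w k) / brPM L c (z i + δ / 2) (w k)) *
      ∏ i ∈ M, ∏ k, brPM L c (z i) (w k) / brPM L c (z i - δ / 2) (w k) := by
    rw [prod_univ_eq_prod_mul_prod_mul_prod hPM,
      prod_eq_one (s := (P ∪ M)ᶜ) fun i hi ↦ by simp [hC i hi, crossFactor], mul_one]
    congr 1
    · refine prod_congr rfl fun i hi ↦ prod_congr rfl fun k _ ↦ ?_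
      rw [hP i hi, crossFactor, if_neg one_ne_zero, SignType.coe_one, one_mul,
        shiftRatio_eq_brPM, inv_div]
    · refine prod_congr rfl fun i hi ↦ prod_congr rfl fun k _ ↦ ?_
      rw [hM i hi, crossFactor, if_neg (by decide), SignType.coe_neg_one, neg_one_mul,
        shiftRatio_neg_eq_brPM, inv_div]
  have hp : ∏ i, ∏ j with i < j, pairFactor (br L c) δ (signs P M i) (signs P M j) (z i) (z j) =
      (∏ i ∈ P, ∏ j ∈ P with i < j, br L c (z i + z j + δ) / br L c (z i + z j))
      * (∏ i ∈ M, ∏ j ∈ M with i < j, br L c (z i + z j - δ) / br L c (z i + z j))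
      * (∏ i ∈ P, ∏ j ∈ M, br L c (z i - z j + δ) / br L c (z i - z j))
      * (∏ i ∈ P, ∏ j ∈ (P ∪ M)ᶜ, brPM L c (z i + δ / 2) (z j) / brPM L c (z i) (z j))
      * (∏ i ∈ M, ∏ j ∈ (P ∪ M)ᶜ, brPM L c (z i - δ / 2) (z j) / brPM L c (z i) (z j)) := by
    have hcomm : ∀ i j, pairFactor (br L c) δ (signs P M i) (signs P M j) (z i) (z j) =
        pairFactor (br L c) δ (signs P M j) (signs P M i) (z j) (z i) := fun _ _ ↦
      pairFactor_comm _ _ _ _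
    rw [← union_compl (P ∪ M), prod_lt_union disjoint_compl_right hcomm, prod_lt_union hPM hcomm,
      prod_union hPM, prod_eq_one (s := (P ∪ M)ᶜ) fun i hi ↦ prod_eq_one fun j hj ↦ by
        rw [hC i hi, hC j (hlt hj), pairFactor, if_pos rfl, if_pos rfl], mul_one, ← mul_assoc]
    congr 1; congr 1; congr 1; congr 1
    · refine prod_congr rfl fun i hi ↦ prod_congr rfl fun j hj ↦ ?_
      rw [hP i hi, hP j (hlt hj), pairFactor, if_neg one_ne_zero, if_neg one_ne_zero,
        SignType.coe_one, one_mul, one_mul]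
    · refine prod_congr rfl fun i hi ↦ prod_congr rfl fun j hj ↦ ?_
      rw [hM i hi, hM j (hlt hj), pairFactor_neg_one_neg_one]
    · refine prod_congr rfl fun i hi ↦ prod_congr rfl fun j hj ↦ ?_
      rw [hP i hi, hM j hj, pairFactor, if_neg one_ne_zero, if_neg (by decide), SignType.coe_one,
        SignType.coe_neg_one, one_mul, neg_one_mul, ← sub_eq_add_neg]
    · refine prod_congr rfl fun i hi ↦ prod_congr rfl fun j hj ↦ ?_
      rw [hP i hi, hC j hj, pairFactor, if_neg one_ne_zero, if_pos rfl, SignType.coe_one, one_mul,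
        shiftRatio_eq_brPM]
    · refine prod_congr rfl fun i hi ↦ prod_congr rfl fun j hj ↦ ?_
      rw [hM i hi, hC j hj, pairFactor, if_neg (by decide), if_pos rfl, SignType.coe_neg_one,
        neg_one_mul, shiftRatio_neg_eq_brPM]
  rw [configTerm, hb, hc, hp, term]
  ring

/-- The sum over all assignments of signs is the generating function of the sums over subsets of
fixed size. -/
lemma configSum_univ {N : ℕ} (z w : Fin N → ℂ) :
    configSum (br L c) δ a q univ univ z w =
      ∑ r ∈ range (N + 1), q ^ r * subsetSum L c δ a z w r := by
  rw [configSum, sum_configs_univ, sum_powerset, card_univ, Fintype.card_fin]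
  refine sum_congr rfl fun r _ ↦ ?_
  rw [subsetSum, mul_sum]
  refine sum_congr rfl fun I hI ↦ ?_
  rw [mul_sum]
  refine sum_congr rfl fun P hP ↦ ?_
  rw [configTerm_signs L c δ a q z w disjoint_sdiff, union_sdiff_of_subset (mem_powerset.mp hP),
    (mem_powersetCard.mp hI).2]

end Bridge

/-- Two polynomial functions with the same values have the same coefficients. -/
lemma eq_of_sum_pow_mul_eq {N : ℕ} {f g : ℕ → ℂ}
    (h : ∀ q : ℂ, ∑ r ∈ range (N + 1), q ^ r * f r = ∑ r ∈ range (N + 1), q ^ r * g r) {r : ℕ}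
    (hr : r ≤ N) : f r = g r := by
  have hp : ∑ i ∈ range (N + 1), Polynomial.X ^ i * Polynomial.C (f i) =
      ∑ i ∈ range (N + 1), Polynomial.X ^ i * Polynomial.C (g i) := by
    refine Polynomial.funext fun q ↦ ?_
    simpa only [Polynomial.eval_finsetSum, Polynomial.eval_mul, Polynomial.eval_C, Polynomial.eval_pow,
      Polynomial.eval_X] using h q
  have := congrArg (fun p ↦ Polynomial.coeff p r) hp
  simpa [Polynomial.finsetSum_coeff, Polynomial.coeff_mul_C, Polynomial.coeff_X_pow,
    Nat.lt_succ_of_le hr] using this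

end TypeCDuality

end

open TypeCDuality in
theorem mainTheorem4 (L : PeriodPair) (c δ : ℂ)
    (hδ : δ ≠ 0) (hδL : ∀ n : ℤ, (n : ℂ) * δ ∈ L.lattice → n = 0)
    (a b : Fin 4 → ℂ) (hb : ∀ p, b p = δ / 2 - a p) (ha : ∑ p, a p = δ)
    (N r : ℕ) (hr : r ≤ N) (z w : Fin N → ℂ)
    (hz : ∀ i, br L c (2 * z i) ≠ 0)
    (hw : ∀ k, br L c (2 * w k) ≠ 0)
    (hzz : ∀ i j, i ≠ j → brPM L c (z i) (z j) ≠ 0)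
    (hww : ∀ k l, k ≠ l → brPM L c (w k) (w l) ≠ 0)
    (hzw₁ : ∀ i k, brPM L c (z i + δ / 2) (w k) ≠ 0)
    (hzw₂ : ∀ i k, brPM L c (z i - δ / 2) (w k) ≠ 0) :
    subsetSum L c δ a z w r = (-1) ^ r * subsetSum L c δ b w z r := by
  have hδ' : δ ∉ L.lattice := fun h ↦ one_ne_zero (hδL 1 (by simpa using h))
  have hreg : Regular (br L c) δ Finset.univ Finset.univ z w :=
    { two_left := fun i _ ↦ hz i
      two_right := fun k _ ↦ hw k
      left := fun i _ j _ ↦ hzz i j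
      right := fun k _ l _ ↦ hww k l
      cross := fun i _ k _ ↦ ⟨hzw₁ i k, hzw₂ i k⟩ }
  refine eq_of_sum_pow_mul_eq (N := N) (f := subsetSum L c δ a z w)
    (g := fun r ↦ (-1) ^ r * subsetSum L c δ b w z r) (fun q ↦ ?_) hr
  rw [← configSum_univ, configSum_duality (isSigmaLike_br L c) hδ' ha hb rfl hreg, configSum_univ]
  refine Finset.sum_congr rfl fun r _ ↦ ?_
  rw [neg_pow]
  ring
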